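/- Let $k$ be an algebraically closed field and $C$ a finite-dimensional $k$-coalgebra; comodules are left comodules, and a representation is a finite-dimensional comodule. Let $(\Lambda,\le)$ be a partially ordered set and $\{L(\lambda)\mid\lambda\in\Lambda\}$ a complete set of pairwise non-isomorphic simple $C$-comodules. For each $\lambda$ let $L(\lambda)\subset I(\lambda)$ be an injective hull and $P(\lambda)\to L(\lambda)$ a projective cover, and let $N(\lambda)$ be the maximal strict subcomodule of $P(\lambda)$. For $\pi\subset\Lambda$ and a representation $V$, let $O_\pi(V)$ be the largest subcomodule of $V$ all of whose composition factors are of the form $L(\mu)$ with $\mu\in\pi$, and let $O^\pi(V)$ be the smallest subcomodule $U$ of $V$ such that all composition factors of $V/U$ are of the form $L(\mu)$ with $\mu\in\pi$. Put $\pi^{<}(\lambda)=\{\mu\mid\mu<\lambda\}$ and $\pi^{\le}(\lambda)=\{\mu\mid\mu\le\lambda\}$. The costandard and standard comodules in the sense of Donkin are the subcomodule $\nabla_D(\lambda)$ of $I(\lambda)$ containing $L(\lambda)$ with $\nabla_D(\lambda)/L(\lambda)=O_{\pi^{<}(\lambda)}(I(\lambda)/L(\lambda))$, and the quotient $\Delta_D(\lambda)=P(\lambda)/O^{\pi^{<}(\lambda)}(N(\lambda))$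 of $P(\lambda)$. Those in the sense of Dlab–Ringel are $\nabla_{DR}(\lambda)=O_{\pi^{\le}(\lambda)}(I(\lambda))\subset I(\lambda)$ and the quotient $\Delta_{DR}(\lambda)=P(\lambda)/O^{\pi^{\le}(\lambda)}(P(\lambda))$ of $P(\lambda)$. For $\nabla=\nabla_D$ or $\nabla_{DR}$, let $\mathcal F(\nabla)$ be the class of representations $V$ having a finite filtration by subcomodules with subquotients isomorphic to comodules $\nabla(\mu)$. For $V\in\mathcal F(\nabla_D)$, the number $(V:\nabla_D(\mu))$ of subquotients isomorphic to $\nabla_D(\mu)$ does not depend on the filtration. The coalgebra $C$ is called D-quasi-hereditary if for all $\lambda\in\Lambda$: $I(\lambda)\in\mathcal F(\nabla_D)$; $(I(\lambda):\nabla_D(\lambda))=1$; and $(I(\lambda):\nabla_D(\mu))\ne0$ implies $\mu\ge\lambda$. It is called DR-quasi-hereditary if: $(\Lambda,\le)$ is adapted, meaning that for every representation $V$ with $\mathrm{top}(V)\cong L(\lambda_1)$ and $\mathrm{soc}(V)\cong L(\lambda_2)$, where $\lambda_1,\lambda_2$ are incomparable, there is $\mu$ with $\mu>\lambda_1$, $\mu>\lambda_2$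 and $[V:L(\mu)]\neq 0$; the endomorphism ring of every $\nabla_{DR}(\lambda)$ is a division ring; and $C$, as a left comodule over itself, lies in $\mathcal F(\nabla_{DR})$. Then: (a) $C$ is D-quasi-hereditary if and only if it is DR-quasi-hereditary. (b) In that case $\nabla_D(\lambda)=\nabla_{DR}(\lambda)$ (as subcomodules of $I(\lambda)$) and $\Delta_D(\lambda)=\Delta_{DR}(\lambda)$ (as quotients of $P(\lambda)$) for all $\lambda\in\Lambda$. (c) $C$ is D-quasi-hereditary if and only if $C$, as a left comodule over itself, lies in $\mathcal F(\nabla_D)$ and, for all $\lambda,\mu\in\Lambda$, $\operatorname{Ext}^1(L(\mu),\nabla_D(\lambda))\neq0$ implies $\mu>\lambda$. -/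

import Mathlib

open scoped TensorProduct

universe u w

/-- A left comodule `V` over the `k`-coalgebra `C`: a `k`-linear coaction `V → C ⊗ V` which is
coassociative and counital. -/
class LeftComodule (k C V : Type*) [Field k] [AddCommGroup C] [Module k C] [Coalgebra k C]
    [AddCommGroup V] [Module k V] where
  coact : V →ₗ[k] C ⊗[k] V
  coassoc : (TensorProduct.assoc k C C V).toLinearMap ∘ₗ
      (Coalgebra.comul (R := k) (A := C)).rTensor V ∘ₗ coact = coact.lTensor C ∘ₗ coact
  counit_coact : (Coalgebra.counit (R := k) (A := C)).rTensor V ∘ₗ coact =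
      TensorProduct.mk k k V 1

namespace QHCoalg

section Linear

variable {k C V : Type*} [Field k] [AddCommGroup C] [Module k C] [AddCommGroup V] [Module k V]

/-- Membership in `C ⊗ U` is tested by contracting with the functionals on `C`. -/
theorem mem_range_lTensor_iff (U : Submodule k V) (t : C ⊗[k] V) :
    t ∈ LinearMap.range (U.subtype.lTensor C) ↔
      ∀ f : C →ₗ[k] k, TensorProduct.lid k V (f.rTensor V t) ∈ U := by
  constructor
  · rintro ⟨s, rfl⟩ f
    induction s using TensorProduct.induction_on with
    | zero => simp
    | tmul c x => simpa using U.smul_mem _ x.2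
    | add x y hx hy => simpa only [map_add] using U.add_mem hx hy
  · intro h
    have hex := lTensor_exact C (f := U.subtype) (g := U.mkQ)
      (by rw [LinearMap.exact_iff]; simp) U.mkQ_surjective
    refine (hex t).1 ?_
    let b := Module.Free.chooseBasis k C
    apply (TensorProduct.equivFinsuppOfBasisLeft (N := V ⧸ U) b).injective
    ext i
    rw [TensorProduct.equivFinsuppOfBasisLeft_apply, map_zero, Finsupp.zero_apply]
    have key : ∀ s : C ⊗[k] V, TensorProduct.lid k (V ⧸ U)
        ((b.coord i).rTensor _ (U.mkQ.lTensor C s)) =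
          U.mkQ (TensorProduct.lid k V ((b.coord i).rTensor V s)) := by
      intro s
      induction s using TensorProduct.induction_on with
      | zero => simp
      | tmul c x => simp
      | add x y hx hy => simp only [map_add, hx, hy]
    rw [key]
    simpa using h (b.coord i)

theorem lTensor_subtype_injective (U : Submodule k V) :
    Function.Injective (U.subtype.lTensor C) :=
  Module.Flat.lTensor_preserves_injective_linearMap _ U.injective_subtype

end Linear

section Basic

variable (k C : Type*) [Field k] [AddCommGroup C] [Module k C] [Coalgebra k C]
variable (V W : Type*) [AddCommGroup V] [Module k V] [LeftComodule k C V]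
  [AddCommGroup W] [Module k W] [LeftComodule k C W]

/-- The coaction `V → C ⊗ V`. -/
abbrev coact : V →ₗ[k] C ⊗[k] V := LeftComodule.coact

/-- The coalgebra `C` as a left comodule over itself, with coaction the comultiplication. -/
instance instSelf : LeftComodule k C C where
  coact := Coalgebra.comul
  coassoc := Coalgebra.coassoc
  counit_coact := Coalgebra.rTensor_counit_comp_comul

/-- Homomorphisms of left comodules. -/
structure ComodHom extends V →ₗ[k] W where
  map_coact : coact k C W ∘ₗ toLinearMap = toLinearMap.lTensor C ∘ₗ coact k C V

/-- Two comodules are isomorphic. -/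
def Isomorphic : Prop :=
  ∃ e : V ≃ₗ[k] W, coact k C W ∘ₗ e.toLinearMap = e.toLinearMap.lTensor C ∘ₗ coact k C V

/-- A subcomodule of `V`: a linear subspace `U` whose coaction lands in (the image of) `C ⊗ U`. -/
@[ext]
structure Subcomodule extends Submodule k V where
  coact_mem : ∀ v ∈ toSubmodule,
    coact k C V v ∈ LinearMap.range (toSubmodule.subtype.lTensor C)

end Basic

section SubQuot

variable {k C : Type*} [Field k] [AddCommGroup C] [Module k C] [Coalgebra k C]
variable {V W : Type*} [AddCommGroup V] [Module k V] [LeftComodule k C V]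
  [AddCommGroup W] [Module k W] [LeftComodule k C W]

namespace Subcomodule

theorem contract_mem (U : Subcomodule k C V) {v : V} (hv : v ∈ U.toSubmodule) (f : C →ₗ[k] k) :
    TensorProduct.lid k V (f.rTensor V (coact k C V v)) ∈ U.toSubmodule :=
  (mem_range_lTensor_iff _ _).1 (U.coact_mem v hv) f

/-- A linear subspace stable under the contractions of the coaction is a subcomodule. -/
def ofContract (U : Submodule k V) (h : ∀ v ∈ U, ∀ f : C →ₗ[k] k,
    TensorProduct.lid k V (f.rTensor V (coact k C V v)) ∈ U) : Subcomodule k C V where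
  toSubmodule := U
  coact_mem v hv := (mem_range_lTensor_iff _ _).2 (h v hv)

/-- The sum of a family of subcomodules. -/
def sSup (S : Set (Subcomodule k C V)) : Subcomodule k C V :=
  ofContract (⨆ U ∈ S, U.toSubmodule) (by
    intro v hv f
    let g : V →ₗ[k] V := (TensorProduct.lid k V).toLinearMap ∘ₗ f.rTensor V ∘ₗ coact k C V
    have : (⨆ U ∈ S, U.toSubmodule) ≤ (⨆ U ∈ S, U.toSubmodule).comap g := by
      refine iSup₂_le fun U hU x hx => ?_
      exact (le_iSup₂ (f := fun (U : Subcomodule k C V) (_ : U ∈ S) => U.toSubmodule) U hU)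
        (U.contract_mem hx f)
    exact this hv)

/-- The intersection of a family of subcomodules. -/
def sInf (S : Set (Subcomodule k C V)) : Subcomodule k C V :=
  ofContract (⨅ U ∈ S, U.toSubmodule) (by
    intro v hv f
    simp only [Submodule.mem_iInf] at hv ⊢
    exact fun U hU => U.contract_mem (hv U hU) f)

theorem hom_contract (g : ComodHom k C V W) (v : V) (f : C →ₗ[k] k) :
    TensorProduct.lid k W (f.rTensor W (coact k C W (g.toLinearMap v))) =
      g.toLinearMap (TensorProduct.lid k V (f.rTensor V (coact k C V v))) := by
  have h := LinearMap.congr_fun g.map_coact v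
  simp only [LinearMap.comp_apply] at h
  rw [h]
  generalize coact k C V v = t
  induction t using TensorProduct.induction_on with
  | zero => simp
  | tmul c x => simp
  | add x y hx hy => simp only [map_add, hx, hy]

/-- The inverse image of a subcomodule. -/
def comap (g : ComodHom k C V W) (U : Subcomodule k C W) : Subcomodule k C V :=
  ofContract (U.toSubmodule.comap g.toLinearMap) (by
    intro v hv f
    rw [Submodule.mem_comap, ← hom_contract]
    exact U.contract_mem hv f)

/-- The image of a subcomodule. -/
def map (g : ComodHom k C V W) (U : Subcomodule k C V) : Subcomodule k C W :=
  ofContract (U.toSubmodule.map g.toLinearMap) (by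
    rintro _ ⟨v, hv, rfl⟩ f
    rw [hom_contract]
    exact ⟨_, U.contract_mem hv f, rfl⟩)

/-- The range of a comodule homomorphism. -/
def range (g : ComodHom k C V W) : Subcomodule k C W :=
  ofContract (LinearMap.range g.toLinearMap) (by
    rintro _ ⟨v, rfl⟩ f
    rw [hom_contract]
    exact ⟨_, rfl⟩)

/-- The coaction restricted to a subcomodule. -/
noncomputable def coactSub (U : Subcomodule k C V) : U.toSubmodule →ₗ[k] C ⊗[k] U.toSubmodule :=
  (LinearEquiv.ofInjective _ (lTensor_subtype_injective (C := C) U.toSubmodule)).symm.toLinearMap ∘ₗ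
    (coact k C V ∘ₗ U.toSubmodule.subtype).codRestrict _ (fun x => U.coact_mem x x.2)

theorem lTensor_coactSub (U : Subcomodule k C V) :
    U.toSubmodule.subtype.lTensor C ∘ₗ U.coactSub = coact k C V ∘ₗ U.toSubmodule.subtype := by
  ext x
  have := LinearEquiv.ofInjective_symm_apply
    (f := U.toSubmodule.subtype.lTensor C) (h := lTensor_subtype_injective (C := C) U.toSubmodule)
    ((coact k C V ∘ₗ U.toSubmodule.subtype).codRestrict _ (fun x => U.coact_mem x x.2) x)
  exact this

/-- A subcomodule is a comodule. -/
noncomputable instance instSub (U : Subcomodule k C V) : LeftComodule k C U.toSubmodule where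
  coact := U.coactSub
  coassoc := by
    have h := U.lTensor_coactSub
    have hinj : Function.Injective ((U.toSubmodule.subtype.lTensor C).lTensor C) :=
      Module.Flat.lTensor_preserves_injective_linearMap _ (lTensor_subtype_injective _)
    apply LinearMap.cancel_left hinj |>.1
    have e1 : (U.toSubmodule.subtype.lTensor C).lTensor C ∘ₗ
        (TensorProduct.assoc k C C U.toSubmodule).toLinearMap =
        (TensorProduct.assoc k C C V).toLinearMap ∘ₗ U.toSubmodule.subtype.lTensor (C ⊗[k] C) := by
      ext; simp
    have e2 : U.toSubmodule.subtype.lTensor (C ⊗[k] C) ∘ₗ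
        (Coalgebra.comul (R := k) (A := C)).rTensor U.toSubmodule =
        (Coalgebra.comul (R := k) (A := C)).rTensor V ∘ₗ U.toSubmodule.subtype.lTensor C := by
      rw [LinearMap.lTensor_comp_rTensor, LinearMap.rTensor_comp_lTensor]
    calc _ = (TensorProduct.assoc k C C V).toLinearMap ∘ₗ
          (Coalgebra.comul (R := k) (A := C)).rTensor V ∘ₗ
            U.toSubmodule.subtype.lTensor C ∘ₗ U.coactSub := by
          rw [← LinearMap.comp_assoc, e1, LinearMap.comp_assoc, ← LinearMap.comp_assoc _ _
            (U.toSubmodule.subtype.lTensor (C ⊗[k] C)), e2, LinearMap.comp_assoc]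
      _ = (coact k C V).lTensor C ∘ₗ coact k C V ∘ₗ U.toSubmodule.subtype := by
          rw [h, ← LinearMap.comp_assoc, ← LinearMap.comp_assoc]
          rw [LinearMap.comp_assoc _ _ (TensorProduct.assoc k C C V).toLinearMap,
            LeftComodule.coassoc, LinearMap.comp_assoc]
      _ = (coact k C V ∘ₗ U.toSubmodule.subtype).lTensor C ∘ₗ U.coactSub := by
          rw [LinearMap.lTensor_comp, LinearMap.comp_assoc, h]
      _ = _ := by
          rw [← h, LinearMap.lTensor_comp, LinearMap.comp_assoc]
  counit_coact := by
    have h := U.lTensor_coactSub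
    have hinj : Function.Injective (U.toSubmodule.subtype.lTensor k) :=
      Module.Flat.lTensor_preserves_injective_linearMap _ U.toSubmodule.injective_subtype
    apply LinearMap.cancel_left hinj |>.1
    rw [← LinearMap.comp_assoc, LinearMap.lTensor_comp_rTensor, ← LinearMap.rTensor_comp_lTensor,
      LinearMap.comp_assoc, h, ← LinearMap.comp_assoc, LeftComodule.counit_coact]
    ext; simp

/-- The inclusion of a subcomodule. -/
noncomputable def incl (U : Subcomodule k C V) : ComodHom k C U.toSubmodule V where
  toLinearMap := U.toSubmodule.subtype
  map_coact := U.lTensor_coactSub.symm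

/-- The coaction induced on the quotient by a subcomodule. -/
def coactQuot (U : Subcomodule k C V) : (V ⧸ U.toSubmodule) →ₗ[k] C ⊗[k] (V ⧸ U.toSubmodule) :=
  U.toSubmodule.liftQ (U.toSubmodule.mkQ.lTensor C ∘ₗ coact k C V) (by
    intro v hv
    obtain ⟨s, hs⟩ := U.coact_mem v hv
    have h0 : U.toSubmodule.mkQ ∘ₗ U.toSubmodule.subtype = 0 := by ext; simp
    rw [LinearMap.mem_ker, LinearMap.comp_apply, ← hs, ← LinearMap.comp_apply,
      ← LinearMap.lTensor_comp, h0]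
    simp)

theorem coactQuot_comp_mkQ (U : Subcomodule k C V) :
    U.coactQuot ∘ₗ U.toSubmodule.mkQ = U.toSubmodule.mkQ.lTensor C ∘ₗ coact k C V :=
  U.toSubmodule.liftQ_mkQ _ _

/-- The quotient by a subcomodule is a comodule. -/
instance instQuot (U : Subcomodule k C V) : LeftComodule k C (V ⧸ U.toSubmodule) where
  coact := U.coactQuot
  coassoc := by
    have h := U.coactQuot_comp_mkQ
    apply LinearMap.cancel_right U.toSubmodule.mkQ_surjective |>.1
    have e1 : (TensorProduct.assoc k C C (V ⧸ U.toSubmodule)).toLinearMap ∘ₗ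
        U.toSubmodule.mkQ.lTensor (C ⊗[k] C) = (U.toSubmodule.mkQ.lTensor C).lTensor C ∘ₗ
        (TensorProduct.assoc k C C V).toLinearMap := by
      apply TensorProduct.ext_threefold
      intro a b c
      simp
    calc _ = (TensorProduct.assoc k C C (V ⧸ U.toSubmodule)).toLinearMap ∘ₗ
          ((Coalgebra.comul (R := k) (A := C)).rTensor (V ⧸ U.toSubmodule) ∘ₗ
            U.toSubmodule.mkQ.lTensor C) ∘ₗ coact k C V := by
          simp only [LinearMap.comp_assoc, h]
      _ = ((TensorProduct.assoc k C C (V ⧸ U.toSubmodule)).toLinearMap ∘ₗ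
          U.toSubmodule.mkQ.lTensor (C ⊗[k] C)) ∘ₗ
            (Coalgebra.comul (R := k) (A := C)).rTensor V ∘ₗ coact k C V := by
          rw [LinearMap.rTensor_comp_lTensor, ← LinearMap.lTensor_comp_rTensor]
          simp only [LinearMap.comp_assoc]
      _ = (U.toSubmodule.mkQ.lTensor C ∘ₗ coact k C V).lTensor C ∘ₗ coact k C V := by
          rw [e1, LinearMap.comp_assoc, LeftComodule.coassoc, LinearMap.lTensor_comp,
            LinearMap.comp_assoc]
      _ = _ := by
          rw [← h, LinearMap.lTensor_comp]
          simp only [LinearMap.comp_assoc, h]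
  counit_coact := by
    have h := U.coactQuot_comp_mkQ
    apply LinearMap.cancel_right U.toSubmodule.mkQ_surjective |>.1
    rw [LinearMap.comp_assoc, h, ← LinearMap.comp_assoc, LinearMap.rTensor_comp_lTensor,
      ← LinearMap.lTensor_comp_rTensor, LinearMap.comp_assoc, LeftComodule.counit_coact]
    ext; simp

/-- The projection onto the quotient by a subcomodule. -/
def proj (U : Subcomodule k C V) : ComodHom k C V (V ⧸ U.toSubmodule) where
  toLinearMap := U.toSubmodule.mkQ
  map_coact := U.coactQuot_comp_mkQ

/-- The subquotient `U₂ / U₁` (used for `U₁ ≤ U₂`). -/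
abbrev Subquotient (U₁ U₂ : Subcomodule k C V) : Type _ :=
  U₂.toSubmodule ⧸ (comap U₂.incl U₁).toSubmodule

end Subcomodule

end SubQuot

section Notions

variable (k C : Type*) [Field k] [AddCommGroup C] [Module k C] [Coalgebra k C]

/-- A comodule is simple: it is nonzero, and has no subcomodules but zero and itself. -/
def IsSimple (V : Type*) [AddCommGroup V] [Module k V] [LeftComodule k C V] : Prop :=
  Nontrivial V ∧ ∀ U : Subcomodule k C V, U.toSubmodule = ⊥ ∨ U.toSubmodule = ⊤

/-- The simple comodule `S` is a composition factor of (the finite-dimensional comodule) `V`, i.e.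
`[V : S] ≠ 0`: it is isomorphic to a subquotient of `V`. -/
def IsCompositionFactor (V S : Type*) [AddCommGroup V] [Module k V] [LeftComodule k C V]
    [AddCommGroup S] [Module k S] [LeftComodule k C S] : Prop :=
  IsSimple k C S ∧ ∃ U₁ U₂ : Subcomodule k C V, U₁.toSubmodule ≤ U₂.toSubmodule ∧
    Isomorphic k C (Subcomodule.Subquotient U₁ U₂) S

/-- The socle: the sum of all simple subcomodules. -/
def socle (V : Type*) [AddCommGroup V] [Module k V] [LeftComodule k C V] : Subcomodule k C V :=
  Subcomodule.sSup {U | IsSimple k C U.toSubmodule}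

/-- The radical: the intersection of all maximal subcomodules (those with simple quotient).
The top of `V` is `V` modulo its radical. -/
def radical (V : Type*) [AddCommGroup V] [Module k V] [LeftComodule k C V] : Subcomodule k C V :=
  Subcomodule.sInf {U | IsSimple k C (V ⧸ U.toSubmodule)}

/-- A comodule is Schurian: its endomorphism ring is a division ring. -/
def IsSchurian (V : Type*) [AddCommGroup V] [Module k V] [LeftComodule k C V] : Prop :=
  Nontrivial V ∧ ∀ f : ComodHom k C V V, f.toLinearMap ≠ 0 →
    ∃ g : ComodHom k C V V, f.toLinearMap ∘ₗ g.toLinearMap = LinearMap.id ∧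
      g.toLinearMap ∘ₗ f.toLinearMap = LinearMap.id

end Notions

section Homological

variable (k C : Type u) [Field k] [AddCommGroup C] [Module k C] [Coalgebra k C]

/-- `Ext¹(V, W) ≠ 0`: there is a short exact sequence `0 → W → X → V → 0` of comodules that does
not split. -/
def ExtOneNeZero (V W : Type u) [AddCommGroup V] [Module k V] [LeftComodule k C V]
    [AddCommGroup W] [Module k W] [LeftComodule k C W] : Prop :=
  ∃ (X : Type u) (_ : AddCommGroup X) (_ : Module k X) (_ : LeftComodule k C X)
    (i : ComodHom k C W X) (q : ComodHom k C X V),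
    Function.Injective i.toLinearMap ∧ Function.Surjective q.toLinearMap ∧
    LinearMap.range i.toLinearMap = LinearMap.ker q.toLinearMap ∧
    ¬ ∃ s : ComodHom k C V X, q.toLinearMap ∘ₗ s.toLinearMap = LinearMap.id

/-- Injective objects of the category of comodules. -/
def IsInjective (I : Type u) [AddCommGroup I] [Module k I] [LeftComodule k C I] : Prop :=
  ∀ (X Y : Type u) [AddCommGroup X] [Module k X] [LeftComodule k C X]
    [AddCommGroup Y] [Module k Y] [LeftComodule k C Y]
    (f : ComodHom k C X Y) (g : ComodHom k C X I), Function.Injective f.toLinearMap →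
    ∃ h : ComodHom k C Y I, h.toLinearMap ∘ₗ f.toLinearMap = g.toLinearMap

/-- Projective objects of the category of comodules. -/
def IsProjective (P : Type u) [AddCommGroup P] [Module k P] [LeftComodule k C P] : Prop :=
  ∀ (X Y : Type u) [AddCommGroup X] [Module k X] [LeftComodule k C X]
    [AddCommGroup Y] [Module k Y] [LeftComodule k C Y]
    (f : ComodHom k C X Y) (g : ComodHom k C P Y), Function.Surjective f.toLinearMap →
    ∃ h : ComodHom k C P X, f.toLinearMap ∘ₗ h.toLinearMap = g.toLinearMap

variable {k C}

/-- `ι : L → I` is an injective hull: `I` is injective and `ι` is an essential monomorphism. -/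
def IsInjectiveHull {L I : Type u} [AddCommGroup L] [Module k L] [LeftComodule k C L]
    [AddCommGroup I] [Module k I] [LeftComodule k C I] (ι : ComodHom k C L I) : Prop :=
  IsInjective k C I ∧ Function.Injective ι.toLinearMap ∧
    ∀ U : Subcomodule k C I, U.toSubmodule ⊓ LinearMap.range ι.toLinearMap = ⊥ →
      U.toSubmodule = ⊥

/-- `p : P → L` is a projective cover: `P` is projective and `p` is a superfluous epimorphism. -/
def IsProjectiveCover {P L : Type u} [AddCommGroup P] [Module k P] [LeftComodule k C P]
    [AddCommGroup L] [Module k L] [LeftComodule k C L] (p : ComodHom k C P L) : Prop :=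
  IsProjective k C P ∧ Function.Surjective p.toLinearMap ∧
    ∀ U : Subcomodule k C P, U.toSubmodule ⊔ LinearMap.ker p.toLinearMap = ⊤ →
      U.toSubmodule = ⊤

end Homological

section Simples

variable {k C : Type u} [Field k] [AddCommGroup C] [Module k C] [Coalgebra k C]
variable {Λ : Type w} [PartialOrder Λ]
variable (L : Λ → Type u) [∀ l, AddCommGroup (L l)] [∀ l, Module k (L l)]
  [∀ l, LeftComodule k C (L l)]

variable (k C) in
/-- The `L l` form a complete set of pairwise non-isomorphic simple comodules. -/
def IsCompleteSetOfSimples {Λ : Type w} (L : Λ → Type u) [∀ l, AddCommGroup (L l)]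
    [∀ l, Module k (L l)] [∀ l, LeftComodule k C (L l)] : Prop :=
  (∀ l, IsSimple k C (L l)) ∧ (∀ l m, Isomorphic k C (L l) (L m) → l = m) ∧
    ∀ (S : Type u) [AddCommGroup S] [Module k S] [LeftComodule k C S], IsSimple k C S →
      ∃ l, Isomorphic k C S (L l)

variable (k C) in
/-- All composition factors of `V` are of the form `L l` with `l ∈ π`. (Every simple comodule is
isomorphic to a member of the complete set `L`.) -/
def BelongsTo (π : Set Λ) (V : Type u) [AddCommGroup V] [Module k V] [LeftComodule k C V] : Prop :=
  ∀ l, IsCompositionFactor k C V (L l) → l ∈ π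

variable (k C) in
/-- `O_π(V)`: the largest subcomodule of `V` that belongs to `π`. -/
def OSub (π : Set Λ) (V : Type u) [AddCommGroup V] [Module k V] [LeftComodule k C V] :
    Subcomodule k C V :=
  Subcomodule.sSup {U | BelongsTo k C L π U.toSubmodule}

variable (k C) in
/-- `O^π(V)`: the smallest subcomodule `U` of `V` such that `V / U` belongs to `π`. -/
def OSup (π : Set Λ) (V : Type u) [AddCommGroup V] [Module k V] [LeftComodule k C V] :
    Subcomodule k C V :=
  Subcomodule.sInf {U | BelongsTo k C L π (V ⧸ U.toSubmodule)}

section Costandard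

variable {I : Λ → Type u} [∀ l, AddCommGroup (I l)] [∀ l, Module k (I l)]
  [∀ l, LeftComodule k C (I l)]

/-- The Donkin costandard comodule: the subcomodule of `I l` containing `L l` (embedded by `ι l`)
such that `∇ / L l` is `O_π(I l / L l)`, where `π = {m | m < l}`. -/
def nablaD (ι : ∀ l, ComodHom k C (L l) (I l)) (l : Λ) : Subcomodule k C (I l) :=
  Subcomodule.comap (Subcomodule.range (ι l)).proj
    (OSub k C L {m | m < l} (I l ⧸ (Subcomodule.range (ι l)).toSubmodule))

variable (k C I) in
/-- The Dlab–Ringel costandard comodule: the subcomodule `O_π(I l)` of `I l`, where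
`π = {m | m ≤ l}`. -/
def nablaDR (l : Λ) : Subcomodule k C (I l) :=
  OSub k C L {m | m ≤ l} (I l)

end Costandard

section Standard

variable (P : Λ → Type u) [∀ l, AddCommGroup (P l)] [∀ l, Module k (P l)]
  [∀ l, LeftComodule k C (P l)]

variable (k C) in
/-- The maximal strict subcomodule of `V` (for `V` having a largest strict subcomodule). -/
def maxStrict (V : Type u) [AddCommGroup V] [Module k V] [LeftComodule k C V] :
    Subcomodule k C V :=
  Subcomodule.sSup {U | U.toSubmodule ≠ ⊤}

variable (k C) in
/-- The subcomodule `O^π(N l)` of `P l`, where `N l` is the maximal strict subcomodule of `P l` and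
`π = {m | m < l}`. -/
noncomputable def kerDeltaD (l : Λ) : Subcomodule k C (P l) :=
  Subcomodule.map (maxStrict k C (P l)).incl
    (OSup k C L {m | m < l} (maxStrict k C (P l)).toSubmodule)

variable (k C) in
/-- The Donkin standard comodule `P l / O^π(N l)`. -/
abbrev DeltaD (l : Λ) : Type u := P l ⧸ (kerDeltaD k C L P l).toSubmodule

variable (k C) in
/-- The subcomodule `O^π(P l)` of `P l`, where `π = {m | m ≤ l}`. -/
def kerDeltaDR (l : Λ) : Subcomodule k C (P l) :=
  OSup k C L {m | m ≤ l} (P l)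

variable (k C) in
/-- The Dlab–Ringel standard comodule `P l / O^π(P l)`. -/
abbrev DeltaDR (l : Λ) : Type u := P l ⧸ (kerDeltaDR k C L P l).toSubmodule

end Standard

variable (k C) in
/-- The partial order on `Λ` is adapted: every finite-dimensional comodule `V` with simple top
`L l₁` and simple socle `L l₂`, where `l₁` and `l₂` are incomparable, has a composition factor
`L m` with `m > l₁` and `m > l₂`. -/
def IsAdapted : Prop :=
  ∀ (V : Type u) [AddCommGroup V] [Module k V] [LeftComodule k C V] [FiniteDimensional k V]
    (l₁ l₂ : Λ), Isomorphic k C (V ⧸ (radical k C V).toSubmodule) (L l₁) →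
    Isomorphic k C (socle k C V).toSubmodule (L l₂) → ¬ l₁ ≤ l₂ → ¬ l₂ ≤ l₁ →
    ∃ m, l₁ < m ∧ l₂ < m ∧ IsCompositionFactor k C V (L m)

end Simples

section Filtrations

variable (k C : Type u) [Field k] [AddCommGroup C] [Module k C] [Coalgebra k C]
variable {Λ : Type w} (N : Λ → Type u) [∀ l, AddCommGroup (N l)] [∀ l, Module k (N l)]
  [∀ l, LeftComodule k C (N l)]

/-- A finite filtration `0 = F 0 ⊆ F 1 ⊆ ⋯ ⊆ F n = V` by subcomodules, with
`F (i + 1) / F i ≅ N (label i)`. -/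
structure Filtration (V : Type u) [AddCommGroup V] [Module k V] [LeftComodule k C V] where
  n : ℕ
  F : Fin (n + 1) → Subcomodule k C V
  label : Fin n → Λ
  F_zero : (F 0).toSubmodule = ⊥
  F_last : (F (Fin.last n)).toSubmodule = ⊤
  F_le : ∀ i : Fin n, (F i.castSucc).toSubmodule ≤ (F i.succ).toSubmodule
  F_iso : ∀ i : Fin n,
    Isomorphic k C (Subcomodule.Subquotient (F i.castSucc) (F i.succ)) (N (label i))

variable {k C N} in
/-- The number of subquotients of a filtration that carry the label `l`. -/
noncomputable def Filtration.count {V : Type u} [AddCommGroup V] [Module k V] [LeftComodule k C V]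
    (𝓕 : Filtration k C N V) (l : Λ) : ℕ :=
  Nat.card {i : Fin 𝓕.n // 𝓕.label i = l}

/-- `V ∈ F(N)`: the comodule `V` has a filtration with subquotients among the `N l`. -/
def HasFiltration (V : Type u) [AddCommGroup V] [Module k V] [LeftComodule k C V] : Prop :=
  Nonempty (Filtration k C N V)

open Classical in
/-- The multiplicity `(V : N l)` of `N l` in a filtration of `V ∈ F(N)`. (For the costandard
comodules below it does not depend on the filtration.) -/
noncomputable def filtMult (V : Type u) [AddCommGroup V] [Module k V] [LeftComodule k C V]
    (l : Λ) : ℕ :=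
  if h : HasFiltration k C N V then (Classical.choice h).count l else 0

end Filtrations

section QuasiHereditary

variable {k C : Type u} [Field k] [AddCommGroup C] [Module k C] [Coalgebra k C]
variable {Λ : Type w} [PartialOrder Λ]
variable (L : Λ → Type u) [∀ l, AddCommGroup (L l)] [∀ l, Module k (L l)]
  [∀ l, LeftComodule k C (L l)]
variable {I : Λ → Type u} [∀ l, AddCommGroup (I l)] [∀ l, Module k (I l)]
  [∀ l, LeftComodule k C (I l)]

/-- Quasi-hereditary in the sense of Donkin: for every `l`, the injective hull `I l` has a
filtration by the costandard comodules `∇_D`, in which `∇_D l` has multiplicity one and every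
`∇_D m` with nonzero multiplicity satisfies `m ≥ l`. -/
def IsDonkinQH (ι : ∀ l, ComodHom k C (L l) (I l)) : Prop :=
  ∀ l, HasFiltration k C (fun m => (nablaD L ι m).toSubmodule) (I l) ∧
    filtMult k C (fun m => (nablaD L ι m).toSubmodule) (I l) l = 1 ∧
    ∀ m, filtMult k C (fun m => (nablaD L ι m).toSubmodule) (I l) m ≠ 0 → l ≤ m

variable (k C I) in
/-- Quasi-hereditary in the sense of Dlab and Ringel: the partial order is adapted, the costandard
comodules `∇_DR` are Schurian, and `C`, as a left comodule over itself, has a filtration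
by the `∇_DR`. -/
def IsDlabRingelQH : Prop :=
  IsAdapted k C L ∧ (∀ l, IsSchurian k C (nablaDR k C L I l).toSubmodule) ∧
    HasFiltration k C (fun m => (nablaDR k C L I m).toSubmodule) C

end QuasiHereditary

end QHCoalg

/-! Since `C` is finite-dimensional, left comodules are the same as modules over `DualAlg k C`, the
opposite of the convolution algebra. The mathematics takes place over an algebra with simples `L l`,
injective hulls `I l` and projective covers `P l`. Because `k` is algebraically closed, the
multiplicity `[V : L l]` equals both `dim Hom(V, I l)` and `dim Hom(P l, V)`, and most arguments
count these dimensions. Write `∇ l` for `costandard ι l` (Donkin's version) and `Δ l` for `Standard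
A I P l` (the Dlab–Ringel version).

The pivot is `CostandardAbsorbs`: a submodule of `I l` without composition factors above `l` lies in
`∇ l`. Each hypothesis of the theorem forces it: Donkin filtrations of the `I l`
(`costandardAbsorbs_of_filtSub`), adaptedness together with Schurian `∇_DR`
(`costandardAbsorbs_of_adapted`), and the condition on `Ext¹` (`costandardAbsorbs_of_extOrdered`).
In return, absorption identifies the two kinds of costandard and standard modules and gives
adaptedness and the `Ext¹` condition; `∇ l` is Schurian in any case.

It remains to compare filtrations of `C` with filtrations of all the `I l`. Under absorption, `dim V
≤ ∑ m, dim Hom(Δ m, V) * dim (∇ m)`, with equality exactly when `V` is filtered by the `∇ m`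
(`exists_filtSub_iff`); the multiplicities are then the numbers `dim Hom(Δ m, V)` (`filtSub_mult`).
As `dim Hom(W, C) = dim W`, both sides for `C` are sums of the corresponding sides for the `I l`
with weights `dim (L l) > 0`, so equality for `C` means equality for every `I l`
(`exists_filtSub_iff_forall`). No decomposition of `C` into injective hulls is needed. -/

set_option linter.unusedSectionVars false

namespace QHCoalg

/-! ### Dimensions of Hom spaces along short exact sequences -/

section HomRank

variable {k A : Type u} [Field k] [Ring A] [Algebra k A]

theorem finrank_le_add_of_exact {X Y Z : Type*} [AddCommGroup X] [Module k X] [AddCommGroup Y]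
    [Module k Y] [AddCommGroup Z] [Module k Z] [FiniteDimensional k Y] [FiniteDimensional k Z]
    {a : X →ₗ[k] Y} {b : Y →ₗ[k] Z} (ha : Function.Injective a) (h : Function.Exact a b) :
    Module.finrank k Y ≤ Module.finrank k X + Module.finrank k Z := by
  rw [← LinearMap.finrank_range_add_finrank_ker b, h.linearMap_ker_eq,
    LinearMap.finrank_range_of_inj ha, add_comm]
  exact Nat.add_le_add_left (Submodule.finrank_le _) _

theorem finrank_eq_add_of_exact {X Y Z : Type*} [AddCommGroup X] [Module k X] [AddCommGroup Y]
    [Module k Y] [AddCommGroup Z] [Module k Z] [FiniteDimensional k Y]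
    {a : X →ₗ[k] Y} {b : Y →ₗ[k] Z} (ha : Function.Injective a) (h : Function.Exact a b)
    (hb : Function.Surjective b) :
    Module.finrank k Y = Module.finrank k X + Module.finrank k Z := by
  rw [← LinearMap.finrank_range_add_finrank_ker b, h.linearMap_ker_eq,
    LinearMap.finrank_range_of_inj ha, LinearMap.range_eq_top.2 hb, finrank_top, add_comm]

instance finiteDimensional_submodule {V : Type*} [AddCommGroup V] [Module k V] [Module A V]
    [IsScalarTower k A V] [FiniteDimensional k V] (U : Submodule A V) : FiniteDimensional k U :=
  inferInstanceAs (FiniteDimensional k (U.restrictScalars k))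

variable {U V W T : Type u} [AddCommGroup U] [Module k U] [Module A U] [IsScalarTower k A U]
  [AddCommGroup V] [Module k V] [Module A V] [IsScalarTower k A V]
  [AddCommGroup W] [Module k W] [Module A W] [IsScalarTower k A W]
  [AddCommGroup T] [Module k T] [Module A T] [IsScalarTower k A T]

/-- Composition with `f` on the right, as a `k`-linear map of spaces of homomorphisms. -/
def precomp (k : Type u) [Field k] [Algebra k A] [Module k U] [IsScalarTower k A U]
    [Module k V] [IsScalarTower k A V] (T : Type u) [AddCommGroup T]
    [Module k T] [Module A T] [IsScalarTower k A T] (f : U →ₗ[A] V) :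
    (V →ₗ[A] T) →ₗ[k] (U →ₗ[A] T) where
  toFun g := g ∘ₗ f
  map_add' _ _ := rfl
  map_smul' _ _ := rfl

/-- Composition with `f` on the left, as a `k`-linear map of spaces of homomorphisms. -/
def postcomp (k : Type u) [Field k] [Algebra k A] [Module k U] [IsScalarTower k A U]
    [Module k V] [IsScalarTower k A V] (T : Type u) [AddCommGroup T]
    [Module k T] [Module A T] [IsScalarTower k A T] (f : U →ₗ[A] V) :
    (T →ₗ[A] U) →ₗ[k] (T →ₗ[A] V) where
  toFun g := f ∘ₗ g
  map_add' g h := by ext; simp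
  map_smul' c g := by
    ext x
    exact (f.restrictScalars k).map_smul c (g x)

theorem precomp_injective {f : U →ₗ[A] V} (hf : Function.Surjective f) :
    Function.Injective (precomp k T f) := fun _ _ h => (LinearMap.cancel_right hf).1 h

theorem postcomp_injective {f : U →ₗ[A] V} (hf : Function.Injective f) :
    Function.Injective (postcomp k T f) := fun _ _ h => (LinearMap.cancel_left hf).1 h

theorem postcomp_exact {i : U →ₗ[A] V} {q : V →ₗ[A] W} (hi : Function.Injective i)
    (h : Function.Exact i q) : Function.Exact (postcomp k T i) (postcomp k T q) := by
  intro g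
  constructor
  · intro hg
    have hr : ∀ x, g x ∈ LinearMap.range i := fun x => (h _).1 (LinearMap.congr_fun hg x)
    refine ⟨(LinearEquiv.ofInjective i hi).symm.toLinearMap ∘ₗ g.codRestrict _ hr, ?_⟩
    ext x
    exact LinearEquiv.ofInjective_symm_apply (f := i) (h := hi) ⟨g x, hr x⟩
  · rintro ⟨g, rfl⟩
    ext x
    exact h.apply_apply_eq_zero _

theorem exists_comp_eq_of_ker_le {R : Type*} [Ring R] {M N K : Type*} [AddCommGroup M] [Module R M]
    [AddCommGroup N] [Module R N] [AddCommGroup K] [Module R K] {q : M →ₗ[R] N}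
    (hq : Function.Surjective q) {g : M →ₗ[R] K} (h : LinearMap.ker q ≤ LinearMap.ker g) :
    ∃ g' : N →ₗ[R] K, g' ∘ₗ q = g := by
  refine ⟨(LinearMap.ker q).liftQ g h ∘ₗ (q.quotKerEquivOfSurjective hq).symm.toLinearMap, ?_⟩
  ext x
  have hx : (q.quotKerEquivOfSurjective hq).symm (q x) = (LinearMap.ker q).mkQ x := by
    rw [LinearEquiv.symm_apply_eq]
    rfl
  simp [hx]

theorem precomp_exact {i : U →ₗ[A] V} {q : V →ₗ[A] W} (hq : Function.Surjective q)
    (h : Function.Exact i q) : Function.Exact (precomp k T q) (precomp k T i) := by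
  intro g
  constructor
  · intro hg
    have hk : LinearMap.ker q ≤ LinearMap.ker g := by
      intro x hx
      obtain ⟨y, rfl⟩ := (h x).1 hx
      exact LinearMap.congr_fun hg y
    exact exists_comp_eq_of_ker_le hq hk
  · rintro ⟨g, rfl⟩
    ext x
    change g (q (i x)) = 0
    rw [h.apply_apply_eq_zero, map_zero]

variable [FiniteDimensional k V]

theorem finrank_hom_le_add [FiniteDimensional k W] [FiniteDimensional k T]
    {i : U →ₗ[A] V} {q : V →ₗ[A] W} (hi : Function.Injective i)
    (h : Function.Exact i q) : Module.finrank k (T →ₗ[A] V) ≤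
      Module.finrank k (T →ₗ[A] U) + Module.finrank k (T →ₗ[A] W) :=
  finrank_le_add_of_exact (postcomp_injective hi) (postcomp_exact hi h)

theorem finrank_hom_projective [FiniteDimensional k T] [Module.Projective A T]
    {i : U →ₗ[A] V} {q : V →ₗ[A] W}
    (hi : Function.Injective i) (h : Function.Exact i q) (hq : Function.Surjective q) :
    Module.finrank k (T →ₗ[A] V) =
      Module.finrank k (T →ₗ[A] U) + Module.finrank k (T →ₗ[A] W) :=
  finrank_eq_add_of_exact (postcomp_injective hi) (postcomp_exact hi h)
    fun g => Module.projective_lifting_property q g hq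

theorem finrank_hom_injective [FiniteDimensional k T] [Module.Injective A T]
    {i : U →ₗ[A] V} {q : V →ₗ[A] W}
    (hi : Function.Injective i) (h : Function.Exact i q) (hq : Function.Surjective q) :
    Module.finrank k (V →ₗ[A] T) =
      Module.finrank k (U →ₗ[A] T) + Module.finrank k (W →ₗ[A] T) := by
  rw [add_comm]
  refine finrank_eq_add_of_exact (precomp_injective hq) (precomp_exact hq h) fun g => ?_
  obtain ⟨g', hg'⟩ := Module.Injective.out i hi g
  exact ⟨g', LinearMap.ext hg'⟩

theorem finrank_eq_add {i : U →ₗ[A] V} {q : V →ₗ[A] W}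
    (hi : Function.Injective i) (h : Function.Exact i q) (hq : Function.Surjective q) :
    Module.finrank k V = Module.finrank k U + Module.finrank k W :=
  finrank_eq_add_of_exact (a := i.restrictScalars k) (b := q.restrictScalars k) hi h hq

end HomRank

/-! ### Simple modules with their injective hulls and projective covers -/

section SimpleSystem

variable {k A : Type u} [Field k] [Ring A] [Algebra k A] {Λ : Type w}
variable {L I P : Λ → Type u} [∀ l, AddCommGroup (L l)] [∀ l, Module k (L l)]
  [∀ l, Module A (L l)] [∀ l, IsScalarTower k A (L l)]
  [∀ l, AddCommGroup (I l)] [∀ l, Module k (I l)]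
  [∀ l, Module A (I l)] [∀ l, IsScalarTower k A (I l)]
  [∀ l, AddCommGroup (P l)] [∀ l, Module k (P l)]
  [∀ l, Module A (P l)] [∀ l, IsScalarTower k A (P l)]

/-- A complete set of simple modules `L l` with injective hulls `ι l : L l → I l` and projective
covers `p l : P l → L l`. -/
structure SimpleSystem (ι : ∀ l, L l →ₗ[A] I l) (p : ∀ l, P l →ₗ[A] L l) : Prop where
  simple : ∀ l, IsSimpleModule A (L l)
  eq_of_equiv : ∀ l m, Nonempty (L l ≃ₗ[A] L m) → l = m
  complete : ∀ (S : Type u) [AddCommGroup S] [Module A S], IsSimpleModule A S →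
    ∃ l, Nonempty (S ≃ₗ[A] L l)
  injective : ∀ l, Module.Injective A (I l)
  ι_injective : ∀ l, Function.Injective (ι l)
  essential : ∀ l (U : Submodule A (I l)), U ⊓ LinearMap.range (ι l) = ⊥ → U = ⊥
  projective : ∀ l, Module.Projective A (P l)
  p_surjective : ∀ l, Function.Surjective (p l)
  superfluous : ∀ l (U : Submodule A (P l)), U ⊔ LinearMap.ker (p l) = ⊤ → U = ⊤

/-- The simple module with injective hull `I l` is a composition factor of `V`. -/
def Factor (A : Type u) [Ring A] (I : Λ → Type u) [∀ l, AddCommGroup (I l)] [∀ l, Module A (I l)]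
    (V : Type u) [AddCommGroup V] [Module A V] (l : Λ) : Prop :=
  ∃ f : V →ₗ[A] I l, f ≠ 0

variable {ι : ∀ l, L l →ₗ[A] I l} {p : ∀ l, P l →ₗ[A] L l}

namespace SimpleSystem

section

variable (S : SimpleSystem ι p)
include S

theorem isAtom_range (l : Λ) : IsAtom (LinearMap.range (ι l)) := by
  have := S.simple l
  rw [← isSimpleModule_iff_isAtom]
  exact IsSimpleModule.congr (LinearEquiv.ofInjective _ (S.ι_injective l)).symm

/-- Essentiality makes `U` meet the image of `L l`, and that image is an atom. So `L l` is the socle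
of `I l`. -/
theorem range_le {l : Λ} {U : Submodule A (I l)} (hU : U ≠ ⊥) : LinearMap.range (ι l) ≤ U := by
  rcases (S.isAtom_range l).le_iff.1 (inf_le_right (a := U)) with h | h
  · exact absurd (S.essential l U h) hU
  · exact inf_eq_right.1 h

/-- Dual to `range_le`: the kernel of `p l` is both maximal and superfluous, so it is the largest
proper submodule. -/
theorem eq_top_of_not_le {l : Λ} {U : Submodule A (P l)} (hU : ¬ U ≤ LinearMap.ker (p l)) :
    U = ⊤ := by
  have := S.simple l
  apply S.superfluous
  have hco : IsCoatom (LinearMap.ker (p l)) :=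
    LinearMap.isCoatom_ker_of_surjective (S.p_surjective l)
  exact hco.2 _ (right_lt_sup.2 hU)

theorem range_le_of_simple {M : Type u} [AddCommGroup M] [Module A M] [IsSimpleModule A M] {l : Λ}
    (f : M →ₗ[A] I l) : LinearMap.range f ≤ LinearMap.range (ι l) := by
  rcases LinearMap.injective_or_eq_zero f with h | h
  · have hat : IsAtom (LinearMap.range f) := by
      rw [← isSimpleModule_iff_isAtom]
      exact IsSimpleModule.congr (LinearEquiv.ofInjective _ h).symm
    exact (hat.le_iff.1 (S.range_le hat.1)).resolve_left (S.isAtom_range l).1 |>.ge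
  · simp [h]

theorem ker_le_of_simple {M : Type u} [AddCommGroup M] [Module A M] [IsSimpleModule A M] {l : Λ}
    (f : P l →ₗ[A] M) : LinearMap.ker (p l) ≤ LinearMap.ker f := by
  rcases LinearMap.surjective_or_eq_zero f with h | h
  · have hco : IsCoatom (LinearMap.ker f) := LinearMap.isCoatom_ker_of_surjective h
    have hle : LinearMap.ker f ≤ LinearMap.ker (p l) := by
      by_contra hn
      exact hco.1 (S.eq_top_of_not_le hn)
    have := S.simple l
    have hco' : IsCoatom (LinearMap.ker (p l)) :=
      LinearMap.isCoatom_ker_of_surjective (S.p_surjective l)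
    exact ((hco.le_iff.1 hle).resolve_left hco'.1).le
  · simp [h]

theorem eq_of_hom_ne_zero {l m : Λ} {f : L l →ₗ[A] I m} (hf : f ≠ 0) : l = m := by
  have := S.simple l
  have hinj := (LinearMap.injective_or_eq_zero f).resolve_right hf
  have h0 : LinearMap.range f ≠ ⊥ := by rwa [Ne, LinearMap.range_eq_bot]
  have he := le_antisymm (S.range_le_of_simple f) (S.range_le h0)
  exact S.eq_of_equiv l m ⟨(LinearEquiv.ofInjective f hinj).trans
    ((LinearEquiv.ofEq _ _ he).trans (LinearEquiv.ofInjective _ (S.ι_injective m)).symm)⟩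

theorem eq_of_projective_hom_ne_zero {l m : Λ} {f : P l →ₗ[A] L m} (hf : f ≠ 0) : l = m := by
  have := S.simple m
  have := S.simple l
  have hs := (LinearMap.surjective_or_eq_zero f).resolve_right hf
  obtain ⟨g, hg⟩ := exists_comp_eq_of_ker_le (S.p_surjective l) (S.ker_le_of_simple f)
  have hg0 : g ≠ 0 := by
    rintro rfl
    exact hf (by rw [← hg, LinearMap.zero_comp])
  exact S.eq_of_equiv l m ⟨LinearEquiv.ofBijective g
    ((LinearMap.bijective_or_eq_zero g).resolve_right hg0)⟩

end

end SimpleSystem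

end SimpleSystem

/-! ### Composition multiplicities as dimensions of Hom spaces -/

section Multiplicity

variable {k A : Type u} [Field k] [Ring A] [Algebra k A] {Λ : Type w}
variable {L I P : Λ → Type u} [∀ l, AddCommGroup (L l)] [∀ l, Module k (L l)]
  [∀ l, Module A (L l)] [∀ l, IsScalarTower k A (L l)]
  [∀ l, AddCommGroup (I l)] [∀ l, Module k (I l)]
  [∀ l, Module A (I l)] [∀ l, IsScalarTower k A (I l)]
  [∀ l, AddCommGroup (P l)] [∀ l, Module k (P l)]
  [∀ l, Module A (P l)] [∀ l, IsScalarTower k A (P l)]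
variable {ι : ∀ l, L l →ₗ[A] I l} {p : ∀ l, P l →ₗ[A] L l}

/-- Schur's lemma: the endomorphism ring is a finite-dimensional division algebra over an
algebraically closed field. -/
theorem finrank_end_simple [IsAlgClosed k] {M : Type u} [AddCommGroup M] [Module k M] [Module A M]
    [IsScalarTower k A M] [FiniteDimensional k M] [IsSimpleModule A M] :
    Module.finrank k (M →ₗ[A] M) = 1 := by
  classical
  have : FiniteDimensional k (Module.End A M) := inferInstanceAs (FiniteDimensional k (M →ₗ[A] M))
  have h := IsAlgClosed.algebraMap_bijective_of_isIntegral (k := k) (K := Module.End A M)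
  have e : k ≃ₗ[k] Module.End A M := LinearEquiv.ofBijective (Algebra.linearMap k _) h
  exact e.finrank_eq.symm.trans (Module.finrank_self k)

theorem factor_of_surjective {U V : Type u} [AddCommGroup U] [Module A U] [AddCommGroup V]
    [Module A V] {f : U →ₗ[A] V} (hf : Function.Surjective f) {l : Λ} (h : Factor A I V l) :
    Factor A I U l := by
  obtain ⟨g, hg⟩ := h
  refine ⟨g ∘ₗ f, fun h0 => hg ?_⟩
  exact (LinearMap.cancel_right hf).1 (h0.trans (LinearMap.zero_comp f).symm)

theorem factor_congr {U V : Type u} [AddCommGroup U] [Module A U] [AddCommGroup V]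
    [Module A V] (e : U ≃ₗ[A] V) {l : Λ} : Factor A I U l ↔ Factor A I V l :=
  ⟨factor_of_surjective e.symm.surjective, factor_of_surjective e.surjective⟩

/-- A nonzero map `V → I l` either survives on `U` or descends to `W`. -/
theorem factor_or_of_exact {U V W : Type u} [AddCommGroup U] [Module A U] [AddCommGroup V]
    [Module A V] [AddCommGroup W] [Module A W] {i : U →ₗ[A] V} {q : V →ₗ[A] W}
    (hq : Function.Surjective q) (h : Function.Exact i q) {l : Λ}
    (hV : Factor A I V l) : Factor A I U l ∨ Factor A I W l := by
  obtain ⟨g, hg⟩ := hV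
  by_cases h0 : g ∘ₗ i = 0
  · right
    obtain ⟨g', rfl⟩ := exists_comp_eq_of_ker_le hq (g := g) (by
      intro x hx
      obtain ⟨y, rfl⟩ := (h x).1 hx
      exact LinearMap.congr_fun h0 y)
    refine ⟨g', ?_⟩
    rintro rfl
    exact hg (LinearMap.zero_comp _)
  · exact Or.inl ⟨_, h0⟩

variable {V : Type u} [AddCommGroup V] [Module k V] [Module A V] [IsScalarTower k A V]
  [FiniteDimensional k V]

theorem factor_iff_finrank_ne_zero [∀ l, FiniteDimensional k (I l)] {l : Λ} :
    Factor A I V l ↔ Module.finrank k (V →ₗ[A] I l) ≠ 0 := by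
  rw [← Nat.pos_iff_ne_zero, Module.finrank_pos_iff]
  exact ⟨fun ⟨f, hf⟩ => nontrivial_of_ne f 0 hf, fun _ => exists_ne 0⟩

namespace SimpleSystem

variable (S : SimpleSystem ι p)
include S

theorem factor_of_injective {U V : Type u} [AddCommGroup U] [Module A U] [AddCommGroup V]
    [Module A V] {f : U →ₗ[A] V} (hf : Function.Injective f) {l : Λ} (h : Factor A I U l) :
    Factor A I V l := by
  obtain ⟨g, hg⟩ := h
  obtain ⟨g', hg'⟩ := (S.injective l).out f hf g
  refine ⟨g', ?_⟩
  rintro rfl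
  exact hg (LinearMap.ext fun x => (hg' x).symm)

theorem factor_submodule_iff {V : Type u} [AddCommGroup V] [Module A V] {U : Submodule A V}
    {l : Λ} : Factor A I U l ↔ ∃ f : V →ₗ[A] I l, ¬ U ≤ LinearMap.ker f := by
  constructor
  · rintro ⟨g, hg⟩
    obtain ⟨f, hf⟩ := (S.injective l).out U.subtype U.subtype_injective g
    refine ⟨f, fun h => hg (LinearMap.ext fun x => ?_)⟩
    rw [← hf]
    exact h x.2
  · rintro ⟨f, hf⟩
    refine ⟨f ∘ₗ U.subtype, fun h => hf fun x hx => LinearMap.congr_fun h ⟨x, hx⟩⟩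

theorem factor_simple_iff {l m : Λ} : Factor A I (L l) m ↔ l = m := by
  constructor
  · rintro ⟨f, hf⟩
    exact S.eq_of_hom_ne_zero hf
  · rintro rfl
    refine ⟨ι l, fun h => ?_⟩
    have := S.simple l
    have := IsSimpleModule.nontrivial A (L l)
    obtain ⟨x, hx⟩ := exists_ne (0 : L l)
    exact hx (S.ι_injective l (by simp [h]))

theorem exists_factor {V : Type u} [AddCommGroup V] [Module k V] [Module A V]
    [IsScalarTower k A V] [FiniteDimensional k V] [Nontrivial V] :
    ∃ (l : Λ) (U : Submodule A V), Nonempty (U ≃ₗ[A] L l) := by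
  have : IsArtinian A V := isArtinian_of_tower k inferInstance
  obtain ⟨U, hU⟩ := IsAtomic.exists_atom (Submodule A V)
  have := isSimpleModule_iff_isAtom.2 hU
  obtain ⟨l, hl⟩ := S.complete U this
  exact ⟨l, U, hl⟩

/-- Induction along a composition series. -/
theorem induction_on {motive : ∀ (V : Type u) [AddCommGroup V] [Module k V] [Module A V]
      [IsScalarTower k A V] [FiniteDimensional k V], Prop}
    (zero : ∀ (V : Type u) [AddCommGroup V] [Module k V] [Module A V]
      [IsScalarTower k A V] [FiniteDimensional k V], Subsingleton V → motive V)
    (step : ∀ (V W : Type u) [AddCommGroup V] [Module k V] [Module A V]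
      [IsScalarTower k A V] [FiniteDimensional k V] [AddCommGroup W] [Module k W] [Module A W]
      [IsScalarTower k A W] [FiniteDimensional k W] (l : Λ) (i : L l →ₗ[A] V) (q : V →ₗ[A] W),
      Function.Injective i → Function.Exact i q → Function.Surjective q → motive W → motive V)
    (V : Type u) [AddCommGroup V] [Module k V] [Module A V]
      [IsScalarTower k A V] [FiniteDimensional k V] : motive V := by
  induction hn : Module.finrank k V using Nat.strong_induction_on generalizing V with
  | _ n ih =>
    subst hn
    rcases subsingleton_or_nontrivial V with h | h
    · exact zero V h
    obtain ⟨l, U, ⟨e⟩⟩ := S.exists_factor (k := k) (V := V)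
    have := S.simple l
    have hnt : Nontrivial U := e.toEquiv.nontrivial_congr.2 (IsSimpleModule.nontrivial A (L l))
    have h1 := finrank_eq_add (k := k) U.subtype_injective (LinearMap.exact_subtype_mkQ U)
      U.mkQ_surjective
    have h2 := Module.finrank_pos (R := k) (M := U)
    refine step V (V ⧸ U) l (U.subtype ∘ₗ e.symm.toLinearMap) U.mkQ
      (U.subtype_injective.comp e.symm.injective) ?_ U.mkQ_surjective (ih _ (by omega) _ rfl)
    intro x
    rw [LinearMap.exact_subtype_mkQ U x]
    constructor
    · rintro ⟨y, rfl⟩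
      exact ⟨e y, by simp⟩
    · rintro ⟨y, rfl⟩
      exact ⟨e.symm y, by simp⟩

theorem finite_factors [∀ l, FiniteDimensional k (L l)] (V : Type u) [AddCommGroup V]
    [Module k V] [Module A V] [IsScalarTower k A V] [FiniteDimensional k V] :
    {l | Factor A I V l}.Finite := by
  refine S.induction_on (k := k) (motive := fun V _ _ _ _ _ => {l | Factor A I V l}.Finite)
    ?_ ?_ V
  · intro V _ _ _ _ _ _
    convert Set.finite_empty
    ext l
    simp only [Set.mem_ofPred_eq, Set.mem_empty_iff_false, iff_false]
    rintro ⟨f, hf⟩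
    exact hf (LinearMap.ext fun x => by rw [Subsingleton.elim x 0, map_zero, map_zero])
  · intro V W _ _ _ _ _ _ _ _ _ _ l i q hi h hq hW
    refine (hW.union (Set.finite_singleton l)).subset fun m hm => ?_
    rcases factor_or_of_exact hq h hm with h' | h'
    · exact Or.inr (S.factor_simple_iff.1 h').symm
    · exact Or.inl h'

variable [IsAlgClosed k] [∀ l, FiniteDimensional k (L l)] [∀ l, FiniteDimensional k (I l)]
  [∀ l, FiniteDimensional k (P l)]

/-- Maps from `L l` to `I l` land in the socle, so they are the endomorphisms of `L l`. -/
theorem finrank_simple_self (l : Λ) : Module.finrank k (L l →ₗ[A] I l) = 1 := by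
  have := S.simple l
  rw [← finrank_end_simple (k := k) (A := A) (M := L l)]
  refine (LinearEquiv.ofBijective _ ⟨postcomp_injective (k := k) (T := L l) (S.ι_injective l),
    fun g => ?_⟩).finrank_eq.symm
  refine ⟨(LinearEquiv.ofInjective (ι l) (S.ι_injective l)).symm.toLinearMap ∘ₗ
    g.codRestrict _ fun x => S.range_le_of_simple g ⟨x, rfl⟩, LinearMap.ext fun x => ?_⟩
  exact LinearEquiv.ofInjective_symm_apply (f := ι l) (h := S.ι_injective l)
    ⟨g x, S.range_le_of_simple g ⟨x, rfl⟩⟩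

theorem finrank_projective_simple_self (l : Λ) : Module.finrank k (P l →ₗ[A] L l) = 1 := by
  have := S.simple l
  rw [← finrank_end_simple (k := k) (A := A) (M := L l)]
  exact (LinearEquiv.ofBijective _ ⟨precomp_injective (k := k) (T := L l) (S.p_surjective l),
    fun g => exists_comp_eq_of_ker_le (S.p_surjective l) (S.ker_le_of_simple g)⟩).finrank_eq.symm

theorem finrank_projective_simple (l m : Λ) :
    Module.finrank k (P l →ₗ[A] L m) = Module.finrank k (L m →ₗ[A] I l) := by
  by_cases h : l = m
  · subst h
    rw [S.finrank_simple_self, S.finrank_projective_simple_self]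
  · have h1 : Subsingleton (P l →ₗ[A] L m) := subsingleton_of_forall_eq 0 fun f => by
      by_contra hf
      exact h (S.eq_of_projective_hom_ne_zero hf)
    have h2 : Subsingleton (L m →ₗ[A] I l) := subsingleton_of_forall_eq 0 fun f => by
      by_contra hf
      exact h (S.eq_of_hom_ne_zero hf).symm
    rw [Module.finrank_zero_of_subsingleton, Module.finrank_zero_of_subsingleton]

/-- Both sides are the multiplicity of `L l` as a composition factor of `V`. -/
theorem finrank_projective_hom (V : Type u) [AddCommGroup V] [Module k V] [Module A V]
    [IsScalarTower k A V] [FiniteDimensional k V] (l : Λ) :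
    Module.finrank k (P l →ₗ[A] V) = Module.finrank k (V →ₗ[A] I l) := by
  -- Both sides are additive, one because `P l` is projective and the other because `I l` is
  -- injective, so it suffices to compare them on simples.
  refine S.induction_on (k := k) (motive := fun V _ _ _ _ _ =>
    Module.finrank k (P l →ₗ[A] V) = Module.finrank k (V →ₗ[A] I l)) ?_ ?_ V
  · intro V _ _ _ _ _ _
    have h1 : Subsingleton (P l →ₗ[A] V) := ⟨fun f g => LinearMap.ext fun x =>
      Subsingleton.elim _ _⟩
    have h2 : Subsingleton (V →ₗ[A] I l) := ⟨fun f g => LinearMap.ext fun x => by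
      rw [Subsingleton.elim x 0, map_zero, map_zero]⟩
    rw [Module.finrank_zero_of_subsingleton, Module.finrank_zero_of_subsingleton]
  · intro V W _ _ _ _ _ _ _ _ _ _ m i q hi h hq hW
    have := S.injective l
    have := S.projective l
    rw [finrank_hom_projective hi h hq, finrank_hom_injective hi h hq, hW,
      S.finrank_projective_simple]

include k in
theorem factor_iff_projective {l : Λ} : Factor A I V l ↔ ∃ g : P l →ₗ[A] V, g ≠ 0 := by
  rw [factor_iff_finrank_ne_zero (k := k), ← S.finrank_projective_hom, ← Nat.pos_iff_ne_zero,
    Module.finrank_pos_iff]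
  exact ⟨fun _ => exists_ne 0, fun ⟨f, hf⟩ => nontrivial_of_ne f 0 hf⟩

include k in
-- Projectivity of `P l` lifts a map into the quotient to a map into `V`, which can then be tested
-- against every member of an intersection at once.
theorem factor_quotient_iff {U : Submodule A V} {l : Λ} :
    Factor A I (V ⧸ U) l ↔ ∃ g : P l →ₗ[A] V, ¬ LinearMap.range g ≤ U := by
  rw [S.factor_iff_projective (k := k)]
  constructor
  · rintro ⟨g, hg⟩
    have := S.projective l
    obtain ⟨g', rfl⟩ := Module.projective_lifting_property U.mkQ g U.mkQ_surjective
    refine ⟨g', fun h => hg ?_⟩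
    rwa [← LinearMap.range_le_ker_iff, Submodule.ker_mkQ]
  · rintro ⟨g, hg⟩
    refine ⟨U.mkQ ∘ₗ g, fun h => hg ?_⟩
    rwa [← LinearMap.range_le_ker_iff, Submodule.ker_mkQ] at h

theorem finrank_eq_sum [Fintype Λ] (V : Type u) [AddCommGroup V] [Module k V] [Module A V]
    [IsScalarTower k A V] [FiniteDimensional k V] :
    Module.finrank k V = ∑ l, Module.finrank k (V →ₗ[A] I l) * Module.finrank k (L l) := by
  classical
  refine S.induction_on (k := k) (motive := fun V _ _ _ _ _ => Module.finrank k V =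
    ∑ l, Module.finrank k (V →ₗ[A] I l) * Module.finrank k (L l)) ?_ ?_ V
  · intro V _ _ _ _ _ _
    symm
    rw [Module.finrank_zero_of_subsingleton]
    refine Finset.sum_eq_zero fun l _ => ?_
    have h2 : Subsingleton (V →ₗ[A] I l) := ⟨fun f g => LinearMap.ext fun x => by
      rw [Subsingleton.elim x 0, map_zero, map_zero]⟩
    rw [Module.finrank_zero_of_subsingleton, zero_mul]
  · intro V W _ _ _ _ _ _ _ _ _ _ m i q hi h hq hW
    have hI : ∀ l, Module.finrank k (V →ₗ[A] I l) = Module.finrank k (L m →ₗ[A] I l) +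
        Module.finrank k (W →ₗ[A] I l) := fun l => by
      have := S.injective l
      exact finrank_hom_injective hi h hq
    rw [finrank_eq_add hi h hq, hW]
    simp only [hI, add_mul, Finset.sum_add_distrib]
    congr 1
    rw [Finset.sum_eq_single m, S.finrank_simple_self, one_mul]
    · intro l _ hl
      have h2 : Subsingleton (L m →ₗ[A] I l) := subsingleton_of_forall_eq 0 fun f => by
        by_contra hf
        exact hl (S.eq_of_hom_ne_zero hf).symm
      rw [Module.finrank_zero_of_subsingleton, zero_mul]
    · simp

end SimpleSystem

end Multiplicity

/-! ### Truncations, costandard submodules and standard quotients -/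

section Costandard

variable {k A : Type u} [Field k] [Ring A] [Algebra k A] {Λ : Type w} [PartialOrder Λ]
variable {L I P : Λ → Type u} [∀ l, AddCommGroup (L l)] [∀ l, Module k (L l)]
  [∀ l, Module A (L l)] [∀ l, IsScalarTower k A (L l)]
  [∀ l, AddCommGroup (I l)] [∀ l, Module k (I l)]
  [∀ l, Module A (I l)] [∀ l, IsScalarTower k A (I l)]
  [∀ l, AddCommGroup (P l)] [∀ l, Module k (P l)]
  [∀ l, Module A (P l)] [∀ l, IsScalarTower k A (P l)]
variable {ι : ∀ l, L l →ₗ[A] I l} {p : ∀ l, P l →ₗ[A] L l}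

/-- The largest submodule of `V` with all composition factors in `π`. -/
def oSub (A : Type u) [Ring A] {Λ : Type w} (I : Λ → Type u) [∀ l, AddCommGroup (I l)]
    [∀ l, Module A (I l)] (π : Set Λ) (V : Type u) [AddCommGroup V] [Module A V] :
    Submodule A V :=
  sSup {U | ∀ m, Factor A I U m → m ∈ π}

/-- The smallest submodule of `V` such that the quotient has all composition factors in `π`. -/
def oSup (A : Type u) [Ring A] {Λ : Type w} (I : Λ → Type u) [∀ l, AddCommGroup (I l)]
    [∀ l, Module A (I l)] (π : Set Λ) (V : Type u) [AddCommGroup V] [Module A V] :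
    Submodule A V :=
  sInf {U | ∀ m, Factor A I (V ⧸ U) m → m ∈ π}

/-- The Donkin costandard submodule of `I l`. -/
def costandard (ι : ∀ l, L l →ₗ[A] I l) (l : Λ) : Submodule A (I l) :=
  (oSub A I (Set.Iio l) (I l ⧸ LinearMap.range (ι l))).comap (LinearMap.range (ι l)).mkQ

variable (k A I P) in
/-- The Dlab–Ringel standard module. -/
abbrev Standard (l : Λ) : Type u := P l ⧸ oSup A I (Set.Iic l) (P l)

/-- A submodule of `I l` none of whose composition factors exceeds `l` lies in `costandard ι l`. -/
def CostandardAbsorbs (ι : ∀ l, L l →ₗ[A] I l) : Prop :=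
  ∀ l (U : Submodule A (I l)), (∀ m, Factor A I U m → ¬ l < m) → U ≤ costandard ι l

theorem oSup_le {π : Set Λ} {V : Type u} [AddCommGroup V] [Module A V] {U : Submodule A V}
    (h : ∀ m, Factor A I (V ⧸ U) m → m ∈ π) : oSup A I π V ≤ U := sInf_le h

theorem le_oSub {π : Set Λ} {V : Type u} [AddCommGroup V] [Module A V] {U : Submodule A V}
    (h : ∀ m, Factor A I U m → m ∈ π) : U ≤ oSub A I π V := le_sSup h


namespace SimpleSystem

variable (S : SimpleSystem ι p)
include S

/-- By injectivity of `I m`, a factor of the sum is a map on all of `V`; if it killed every member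
of the family it would kill the sum. -/
theorem factor_oSub {π : Set Λ} {V : Type u} [AddCommGroup V] [Module A V] {m : Λ}
    (h : Factor A I (oSub A I π V) m) : m ∈ π := by
  obtain ⟨f, hf⟩ := S.factor_submodule_iff.1 h
  by_contra hm
  refine hf (sSup_le fun U hU => ?_)
  by_contra hUf
  exact hm (hU m (S.factor_submodule_iff.2 ⟨f, hUf⟩))

theorem factor_self_of_ne_bot {l : Λ} {U : Submodule A (I l)} (hU : U ≠ ⊥) : Factor A I U l :=
  ⟨U.subtype, fun h => hU (by rw [← U.range_subtype, h, LinearMap.range_zero])⟩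

theorem range_le_costandard (l : Λ) : LinearMap.range (ι l) ≤ costandard ι l := by
  intro x hx
  have : (LinearMap.range (ι l)).mkQ x = 0 := by simpa using hx
  rw [costandard, Submodule.mem_comap, this]
  exact Submodule.zero_mem _

theorem costandard_ne_bot (l : Λ) : costandard ι l ≠ ⊥ := fun h =>
  (S.isAtom_range l).1 (le_bot_iff.1 (h ▸ S.range_le_costandard l))

variable [IsAlgClosed k] [∀ l, FiniteDimensional k (L l)] [∀ l, FiniteDimensional k (I l)]
  [∀ l, FiniteDimensional k (P l)]

include k in
theorem factor_oSup {π : Set Λ} {V : Type u} [AddCommGroup V] [Module k V] [Module A V]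
    [IsScalarTower k A V] [FiniteDimensional k V] {m : Λ}
    (h : Factor A I (V ⧸ oSup A I π V) m) : m ∈ π := by
  obtain ⟨g, hg⟩ := (S.factor_quotient_iff (k := k)).1 h
  by_contra hm
  refine hg (le_sInf fun U hU => ?_)
  by_contra hUf
  exact hm (hU m ((S.factor_quotient_iff (k := k)).2 ⟨g, hUf⟩))

/-- Additivity of the multiplicity of `L l` along `L l → U → U / L l`. -/
theorem finrank_hom_of_range_le {l : Λ} {U : Submodule A (I l)}
    (hU : LinearMap.range (ι l) ≤ U) : Module.finrank k (U →ₗ[A] I l) =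
      1 + Module.finrank k (U.map (LinearMap.range (ι l)).mkQ →ₗ[A] I l) := by
  have := S.injective l
  rw [← S.finrank_simple_self (k := k) l]
  let i : L l →ₗ[A] U := (ι l).codRestrict U fun x => hU ⟨x, rfl⟩
  let q : U →ₗ[A] U.map (LinearMap.range (ι l)).mkQ :=
    (LinearMap.range (ι l)).mkQ.restrict fun x hx => Submodule.mem_map_of_mem hx
  have hi : Function.Injective i := fun x y h => S.ι_injective l (congrArg Subtype.val h)
  have hq : Function.Surjective q := by
    rintro ⟨_, x, hx, rfl⟩
    exact ⟨⟨x, hx⟩, rfl⟩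
  have h : Function.Exact i q := by
    intro x
    have : q x = 0 ↔ (x : I l) ∈ LinearMap.range (ι l) := by
      rw [← Subtype.coe_inj]
      exact Submodule.Quotient.mk_eq_zero _
    rw [this]
    exact ⟨fun ⟨y, hy⟩ => ⟨y, Subtype.ext hy⟩, fun ⟨y, hy⟩ => ⟨y, congrArg Subtype.val hy⟩⟩
  exact finrank_hom_injective hi h hq

theorem finrank_costandard_self (l : Λ) :
    Module.finrank k (costandard ι l →ₗ[A] I l) = 1 := by
  have h2 : (costandard ι l).map (LinearMap.range (ι l)).mkQ =
      oSub A I (Set.Iio l) (I l ⧸ LinearMap.range (ι l)) :=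
    Submodule.map_comap_eq_of_surjective (Submodule.mkQ_surjective _) _
  have h0 : Module.finrank k
      ((costandard ι l).map (LinearMap.range (ι l)).mkQ →ₗ[A] I l) = 0 := by
    by_contra h
    have h1 := (factor_iff_finrank_ne_zero (k := k) (I := I)).2 h
    rw [h2] at h1
    exact lt_irrefl l (S.factor_oSub (π := Set.Iio l) h1)
  have h3 := S.finrank_hom_of_range_le (k := k) (S.range_le_costandard l)
  rwa [h0] at h3

include k in
theorem factor_costandard {l m : Λ} (h : Factor A I (costandard ι l) m) : m ≤ l := by
  by_cases hml : m = l
  · exact hml.le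
  obtain ⟨f, hf⟩ := S.factor_submodule_iff.1 h
  -- As `m ≠ l`, the map `f` kills the socle `L l` and descends to `I l / L l`, where the strict
  -- truncation applies.
  have h0 : LinearMap.range (ι l) ≤ LinearMap.ker f := by
    rw [LinearMap.range_le_ker_iff]
    by_contra h0
    exact hml (S.eq_of_hom_ne_zero h0).symm
  refine le_of_lt (S.factor_oSub (π := Set.Iio l) (S.factor_submodule_iff.2
    ⟨(LinearMap.range (ι l)).liftQ f h0, fun h3 => hf fun x hx => ?_⟩))
  have hx' : (LinearMap.range (ι l)).mkQ x ∈
      oSub A I (Set.Iio l) (I l ⧸ LinearMap.range (ι l)) := hx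
  have := h3 hx'
  simpa using this

/-- The socle uses up the only occurrence of `L l` in `U`, so the factors of `U / L l` are strictly
below `l`. -/
theorem le_costandard {l : Λ} {U : Submodule A (I l)} (hU : LinearMap.range (ι l) ≤ U)
    (h : ∀ m, Factor A I U m → m ≤ l) (h1 : Module.finrank k (U →ₗ[A] I l) ≤ 1) :
    U ≤ costandard ι l := by
  rw [costandard, ← Submodule.map_le_iff_le_comap]
  refine le_oSub fun m hm => ?_
  rw [S.finrank_hom_of_range_le hU] at h1
  have hq : Function.Surjective ((LinearMap.range (ι l)).mkQ.restrict fun x (hx : x ∈ U) =>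
      Submodule.mem_map_of_mem (p := U) hx) := by
    rintro ⟨_, x, hx, rfl⟩
    exact ⟨⟨x, hx⟩, rfl⟩
  refine lt_of_le_of_ne (h m (factor_of_surjective hq hm)) ?_
  rintro rfl
  exact (factor_iff_finrank_ne_zero (k := k)).1 hm (by omega)

end SimpleSystem

end Costandard

/-! ### Filtrations with recorded multiplicities -/

section SubmoduleFiltration

open scoped Classical in
/-- `FiltSub N c U`: the submodule `U` has a filtration in which `N l` occurs `c l` times. -/
inductive FiltSub {A : Type u} [Ring A] {Λ : Type w} (N : Λ → Type u) [∀ l, AddCommGroup (N l)]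
    [∀ l, Module A (N l)] {V : Type u} [AddCommGroup V] [Module A V] :
    (Λ → ℕ) → Submodule A V → Prop
  | bot : FiltSub N 0 ⊥
  -- The layer `U' / U ≅ N l` is recorded as a surjection from `U'` with kernel `U`, which avoids
  -- forming subquotients.
  | step {c : Λ → ℕ} {U U' : Submodule A V} (l : Λ) (g : U' →ₗ[A] N l) (hU : FiltSub N c U)
      (hle : U ≤ U') (hg : Function.Surjective g) (hk : ∀ x, g x = 0 ↔ (x : V) ∈ U) :
      FiltSub N (c + Pi.single l 1) U'

end SubmoduleFiltration

/-! ### Numerical criterion for costandard filtrations -/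

section Core

variable {k A : Type u} [Field k] [Ring A] [Algebra k A] {Λ : Type w} [PartialOrder Λ]
variable {L I P : Λ → Type u} [∀ l, AddCommGroup (L l)] [∀ l, Module k (L l)]
  [∀ l, Module A (L l)] [∀ l, IsScalarTower k A (L l)]
  [∀ l, AddCommGroup (I l)] [∀ l, Module k (I l)]
  [∀ l, Module A (I l)] [∀ l, IsScalarTower k A (I l)]
  [∀ l, AddCommGroup (P l)] [∀ l, Module k (P l)]
  [∀ l, Module A (P l)] [∀ l, IsScalarTower k A (P l)]
variable {ι : ∀ l, L l →ₗ[A] I l} {p : ∀ l, P l →ₗ[A] L l}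

namespace SimpleSystem

variable (S : SimpleSystem ι p)
include S
variable [IsAlgClosed k] [∀ l, FiniteDimensional k (L l)] [∀ l, FiniteDimensional k (I l)]
  [∀ l, FiniteDimensional k (P l)]

theorem eq_of_factor_quotient_ker {l m : Λ} (h : Factor A I (P l ⧸ LinearMap.ker (p l)) m) :
    m = l :=
  (S.factor_simple_iff.1 ((factor_congr
    ((p l).quotKerEquivOfSurjective (S.p_surjective l))).1 h)).symm

theorem oSup_Iic_le_ker (l : Λ) : oSup A I (Set.Iic l) (P l) ≤ LinearMap.ker (p l) :=
  oSup_le fun _ hm => (S.eq_of_factor_quotient_ker hm).le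

theorem factor_standard_self (l : Λ) : Factor A I (Standard A I P l) l := by
  have hq : Function.Surjective (Submodule.factor (S.oSup_Iic_le_ker l)) :=
    Submodule.factor_surjective _
  refine factor_of_surjective hq ?_
  exact (factor_congr ((p l).quotKerEquivOfSurjective (S.p_surjective l))).2
    (S.factor_simple_iff.2 rfl)

include k in
theorem factor_standard {l m : Λ} (h : Factor A I (Standard A I P l) m) : m ≤ l :=
  S.factor_oSup (k := k) (π := Set.Iic l) h

/-- The instance of adaptedness that is needed for quotients of `P l₁`. -/
theorem exists_factor_gt [Finite Λ] (hA : CostandardAbsorbs ι) {V : Type u}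
    [AddCommGroup V] [Module k V] [Module A V] [IsScalarTower k A V] [FiniteDimensional k V]
    {l₁ l₂ : Λ} {g : P l₁ →ₗ[A] V} (hg : Function.Surjective g) (h₂ : Factor A I V l₂)
    (hn : ¬ l₂ ≤ l₁) : ∃ m, l₁ < m ∧ l₂ ≤ m ∧ Factor A I V m := by
  -- The induction climbs from `l₂` to larger labels, which is possible because `Λ` is finite.
  induction l₂ using WellFoundedGT.induction with
  | _ l₂ ih =>
    obtain ⟨f, hf⟩ := h₂
    by_cases hlt : l₁ < l₂
    · exact ⟨l₂, hlt, le_rfl, f, hf⟩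
    by_cases hex : ∃ m, Factor A I (LinearMap.range f) m ∧ l₂ < m
    · obtain ⟨m, hm, hlm⟩ := hex
      obtain ⟨m', h1, h2, h3⟩ := ih m hlm (factor_of_surjective f.surjective_rangeRestrict hm)
        fun h => hn (hlm.le.trans h)
      exact ⟨m', h1, hlm.le.trans h2, h3⟩
    · push Not at hex
      -- By absorption the image of `f` lies in `∇ l₂`. It is a nonzero quotient of `P l₁`, so `L
      -- l₁` is one of its factors and `l₁ ≤ l₂`, which is already excluded.
      have hle := hA l₂ _ hex
      have hfac : Factor A I (LinearMap.range f) l₁ := by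
        refine (S.factor_iff_projective (k := k)).2 ⟨f.rangeRestrict ∘ₗ g, fun h => hf ?_⟩
        rw [← LinearMap.zero_comp g] at h
        have h' := (LinearMap.cancel_right hg).1 h
        rw [← LinearMap.subtype_comp_codRestrict (p := LinearMap.range f) f (fun x => ⟨x, rfl⟩)]
        exact (congrArg ((LinearMap.range f).subtype ∘ₗ ·) h').trans (LinearMap.comp_zero _)
      have hl := S.factor_costandard (k := k)
        (S.factor_of_injective (Submodule.inclusion_injective hle) hfac)
      rcases hl.lt_or_eq with h | h
      · exact absurd h hlt
      · exact absurd h.ge hn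

/-- Every map `P l → V` factors through `Δ l`: its image is a quotient of `P l`, and a factor of it
not below `l` would by `exists_factor_gt` produce one above `l`. Thus `Hom(Δ l, V)` counts the
occurrences of `L l` in `V`. -/
theorem finrank_standard_hom_eq [Finite Λ] (hA : CostandardAbsorbs ι) {V : Type u}
    [AddCommGroup V] [Module k V] [Module A V] [IsScalarTower k A V] [FiniteDimensional k V]
    {l : Λ} (hV : ∀ m, Factor A I V m → ¬ l < m) :
    Module.finrank k (Standard A I P l →ₗ[A] V) = Module.finrank k (V →ₗ[A] I l) := by
  rw [← S.finrank_projective_hom]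
  refine (LinearEquiv.ofBijective _ ⟨precomp_injective (k := k) (T := V)
    (Submodule.mkQ_surjective _), fun g => ?_⟩).finrank_eq
  refine exists_comp_eq_of_ker_le (Submodule.mkQ_surjective _) ?_
  rw [Submodule.ker_mkQ]
  refine oSup_le fun m hm => ?_
  have hm' := (factor_congr g.quotKerEquivRange).1 hm
  by_contra hn
  obtain ⟨m', h1, -, h3⟩ := S.exists_factor_gt hA (k := k) g.surjective_rangeRestrict hm' hn
  exact hV m' (S.factor_of_injective (Submodule.subtype_injective _) h3) h1

theorem finrank_standard_le {V : Type u}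
    [AddCommGroup V] [Module k V] [Module A V] [IsScalarTower k A V] [FiniteDimensional k V]
    (l : Λ) : Module.finrank k (Standard A I P l →ₗ[A] V) ≤ Module.finrank k (V →ₗ[A] I l) := by
  rw [← S.finrank_projective_hom]
  exact LinearMap.finrank_le_finrank_of_injective
    (precomp_injective (k := k) (T := V) (Submodule.mkQ_surjective _))

open scoped Classical in
-- A nonzero map `Δ m → ∇ l` makes `L m` a factor of `∇ l` and `L l` a factor of `Δ m`, so `m ≤ l ≤
-- m`. On the diagonal the bound is `[∇ l : L l] = 1`.
theorem finrank_standard_costandard_le (l m : Λ) :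
    Module.finrank k (Standard A I P m →ₗ[A] costandard ι l) ≤ (Pi.single l 1 : Λ → ℕ) m := by
  by_cases h : m = l
  · subst h
    rw [Pi.single_eq_same]
    exact (S.finrank_standard_le m).trans (S.finrank_costandard_self m).le
  · rw [Pi.single_eq_of_ne h, Nat.le_zero]
    have : Subsingleton (Standard A I P m →ₗ[A] costandard ι l) :=
      subsingleton_of_forall_eq 0 fun f => by
        by_contra hf
        refine h (le_antisymm ?_ ?_)
        · refine S.factor_costandard (k := k) ((S.factor_iff_projective (k := k)).2
            ⟨f ∘ₗ Submodule.mkQ _, fun h0 => hf ?_⟩)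
          exact (LinearMap.cancel_right (Submodule.mkQ_surjective _)).1
            (h0.trans (LinearMap.zero_comp _).symm)
        · refine S.factor_standard (k := k) ⟨(costandard ι l).subtype ∘ₗ f, fun h0 => hf ?_⟩
          exact (LinearMap.cancel_left (Submodule.subtype_injective _)).1
            (h0.trans (LinearMap.comp_zero _).symm)
    exact Module.finrank_zero_of_subsingleton

/-- The factors of `Δ l` are at most `l`, so absorption sends every map `Δ l → I l` into `∇ l`,
where `L l` occurs once. -/
theorem finrank_standard_self [Finite Λ] (hA : CostandardAbsorbs ι) (l : Λ) :
    Module.finrank k (Standard A I P l →ₗ[A] I l) = 1 := by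
  refine le_antisymm ?_ ?_
  · rw [← S.finrank_costandard_self (k := k) l,
      ← S.finrank_standard_hom_eq hA fun m hm => (S.factor_costandard (k := k) hm).not_gt]
    refine (LinearEquiv.ofBijective _ ⟨postcomp_injective (k := k) (T := Standard A I P l)
      (Submodule.subtype_injective (costandard ι l)), fun f => ?_⟩).finrank_eq.ge
    have hr : LinearMap.range f ≤ costandard ι l := hA l _ fun m hm =>
      (S.factor_standard (k := k) (factor_of_surjective f.surjective_rangeRestrict hm)).not_gt
    exact ⟨f.codRestrict _ fun x => hr ⟨x, rfl⟩, rfl⟩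
  · exact Nat.one_le_iff_ne_zero.2 (factor_iff_finrank_ne_zero.1 (S.factor_standard_self l))

variable {V : Type u} [AddCommGroup V] [Module k V] [Module A V] [IsScalarTower k A V]
  [FiniteDimensional k V] [Fintype Λ]

/-- A filtration by costandard modules bounds the ranks of the homomorphisms from the standard
modules. -/
theorem finrank_of_filtSub {c : Λ → ℕ} {U : Submodule A V}
    (h : FiltSub (fun l => costandard ι l) c U) :
    (∀ m, Module.finrank k (Standard A I P m →ₗ[A] U) ≤ c m) ∧
      Module.finrank k U = ∑ m, c m * Module.finrank k (costandard ι m) := by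
  classical
  induction h with
  | bot =>
    refine ⟨fun m => ?_, by simpa using Module.finrank_zero_of_subsingleton⟩
    have : Subsingleton (Standard A I P m →ₗ[A] (⊥ : Submodule A V)) :=
      ⟨fun f g => LinearMap.ext fun x => Subsingleton.elim _ _⟩
    rw [Module.finrank_zero_of_subsingleton]
    exact Nat.zero_le _
  | @step c U U' l g hU hle hg hk ih =>
    have hex : Function.Exact (Submodule.inclusion hle) g := by
      intro x
      rw [hk]
      exact ⟨fun hx => ⟨⟨x, hx⟩, rfl⟩, fun ⟨y, hy⟩ => hy ▸ y.2⟩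
    have hinj := Submodule.inclusion_injective hle
    refine ⟨fun m => ?_, ?_⟩
    -- Left exactness of Hom only bounds the rank from above; equality needs absorption and is
    -- obtained in `filtSub_mult`.
    · refine (finrank_hom_le_add hinj hex).trans (add_le_add (ih.1 m) ?_)
      exact S.finrank_standard_costandard_le l m
    · rw [finrank_eq_add hinj hex hg, ih.2]
      simp only [Pi.add_apply, add_mul, Finset.sum_add_distrib]
      congr 1
      rw [Finset.sum_eq_single l]
      · simp
      · intro m _ hm
        simp [hm]
      · simp

/-- Layers are peeled off from the top. For a maximal factor `l` of `U`, absorption puts the image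
of a nonzero map `U → I l` inside `∇ l`. Passing to its kernel `U₁` lowers the dimension by at most
`dim (∇ l)` and lowers `dim Hom(Δ l, -)` by at least one, which gives the inequality. Equality for
`U` forces the image to be all of `∇ l` and equality for `U₁`, so the filtration is built by
induction. -/
theorem finrank_le_and_filtSub (hA : CostandardAbsorbs ι) (U : Submodule A V) :
    Module.finrank k U ≤ ∑ m, Module.finrank k (Standard A I P m →ₗ[A] U) *
        Module.finrank k (costandard ι m) ∧
      (Module.finrank k U = ∑ m, Module.finrank k (Standard A I P m →ₗ[A] U) *
        Module.finrank k (costandard ι m) → ∃ c, FiltSub (fun l => costandard ι l) c U) := by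
  classical
  induction hn : Module.finrank k U using Nat.strong_induction_on generalizing U with
  | _ n ih =>
    subst hn
    by_cases hbot : U = ⊥
    · subst hbot
      exact ⟨Module.finrank_zero_of_subsingleton.trans_le (Nat.zero_le _), fun _ => ⟨0, FiltSub.bot⟩⟩
    have : Nontrivial U := Submodule.nontrivial_iff_ne_bot.2 hbot
    have hne : {l | Factor A I U l}.Nonempty := by
      obtain ⟨l, U', ⟨e⟩⟩ := S.exists_factor (k := k) (V := U)
      exact ⟨l, S.factor_of_injective U'.subtype_injective
        ((factor_congr e).2 (S.factor_simple_iff.2 rfl))⟩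
    obtain ⟨l, hl⟩ := (Set.toFinite {l | Factor A I U l}).exists_maximal hne
    have hgt : ∀ m, Factor A I U m → ¬ l < m := fun m hm hlm => hl.not_gt hm hlm
    obtain ⟨f, hf⟩ := S.factor_submodule_iff.1 hl.prop
    set U₁ := U ⊓ LinearMap.ker f
    have hle : U₁ ≤ U := inf_le_left
    let g : U →ₗ[A] I l := f ∘ₗ U.subtype
    have hg0 : LinearMap.range g ≠ ⊥ := by
      rw [Ne, LinearMap.range_eq_bot]
      exact fun h => hf fun x hx => LinearMap.congr_fun h ⟨x, hx⟩
    have hgr : LinearMap.range g ≤ costandard ι l := hA l _ fun m hm =>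
      hgt m (factor_of_surjective g.surjective_rangeRestrict hm)
    have hinj := Submodule.inclusion_injective hle
    have hex : Function.Exact (Submodule.inclusion hle) g.rangeRestrict := by
      intro x
      rw [← Subtype.coe_inj]
      change f x = 0 ↔ _
      exact ⟨fun hx => ⟨⟨x, x.2, hx⟩, rfl⟩, fun ⟨y, hy⟩ => hy ▸ y.2.2⟩
    have hdim := finrank_eq_add (k := k) hinj hex g.surjective_rangeRestrict
    have hrank : Module.finrank k (LinearMap.range g) ≤ Module.finrank k (costandard ι l) :=
      LinearMap.finrank_le_finrank_of_injective
        (f := (Submodule.inclusion hgr).restrictScalars k) (Submodule.inclusion_injective hgr)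
    have hpos : 0 < Module.finrank k (LinearMap.range g) := by
      have : Nontrivial (LinearMap.range g) := Submodule.nontrivial_iff_ne_bot.2 hg0
      exact Module.finrank_pos
    have := S.injective l
    have hmult := finrank_hom_injective (k := k) (T := I l) hinj hex g.surjective_rangeRestrict
    have hone : 1 ≤ Module.finrank k (LinearMap.range g →ₗ[A] I l) :=
      Nat.one_le_iff_ne_zero.2 (factor_iff_finrank_ne_zero.1 (S.factor_self_of_ne_bot hg0))
    -- At `m = l` both Hom spaces count occurrences of `L l`, since no factor lies above `l`, and
    -- the image of `g` contains at least one. For other `m` the inclusion `U₁ ≤ U` suffices.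
    have hb : ∀ m, Module.finrank k (Standard A I P m →ₗ[A] U₁) + (Pi.single l 1 : Λ → ℕ) m ≤
        Module.finrank k (Standard A I P m →ₗ[A] U) := by
      intro m
      by_cases hm : m = l
      · subst hm
        rw [S.finrank_standard_hom_eq hA hgt, S.finrank_standard_hom_eq hA fun m' hm' =>
          hgt m' (S.factor_of_injective hinj hm'), Pi.single_eq_same]
        omega
      · rw [Pi.single_eq_of_ne hm, add_zero]
        exact LinearMap.finrank_le_finrank_of_injective (postcomp_injective (k := k) hinj)
    have hsum : (∑ m, Module.finrank k (Standard A I P m →ₗ[A] U₁) *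
        Module.finrank k (costandard ι m)) + Module.finrank k (costandard ι l) ≤
        ∑ m, Module.finrank k (Standard A I P m →ₗ[A] U) * Module.finrank k (costandard ι m) := by
      calc _ = ∑ m, (Module.finrank k (Standard A I P m →ₗ[A] U₁) + (Pi.single l 1 : Λ → ℕ) m) *
          Module.finrank k (costandard ι m) := by
            simp only [add_mul, Finset.sum_add_distrib]
            congr 1
            rw [Finset.sum_eq_single l]
            · simp
            · intro m _ hm
              simp [hm]
            · simp
        _ ≤ _ := Finset.sum_le_sum fun m _ => Nat.mul_le_mul_right _ (hb m)
    obtain ⟨ih1, ih2⟩ := ih _ (by omega) U₁ rfl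
    refine ⟨by omega, fun heq => ?_⟩
    obtain ⟨c, hc⟩ := ih2 (by omega)
    -- Equality in the total bound leaves no slack in `hrank`.
    have hsurj : LinearMap.range g = costandard ι l := by
      have h1 : (LinearMap.range g).restrictScalars k = (costandard ι l).restrictScalars k :=
        Submodule.eq_of_le_of_finrank_eq hgr (by
          change Module.finrank k (LinearMap.range g) = Module.finrank k (costandard ι l)
          omega)
      exact Submodule.restrictScalars_injective k _ _ h1
    refine ⟨_, FiltSub.step l (g.codRestrict (costandard ι l) fun x => hgr ⟨x, rfl⟩) hc hle ?_ ?_⟩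
    · rintro ⟨y, hy⟩
      rw [← hsurj] at hy
      obtain ⟨x, rfl⟩ := hy
      exact ⟨x, rfl⟩
    · intro x
      rw [← Subtype.coe_inj]
      change f x = 0 ↔ _
      exact ⟨fun hx => ⟨x.2, hx⟩, fun hx => hx.2⟩

end SimpleSystem

end Core

/-! ### Absorption: the conditions that imply it and its consequences -/

section Characterization

variable {k A : Type u} [Field k] [Ring A] [Algebra k A] {Λ : Type w} [PartialOrder Λ]
variable {L I P : Λ → Type u} [∀ l, AddCommGroup (L l)] [∀ l, Module k (L l)]
  [∀ l, Module A (L l)] [∀ l, IsScalarTower k A (L l)]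
  [∀ l, AddCommGroup (I l)] [∀ l, Module k (I l)]
  [∀ l, Module A (I l)] [∀ l, IsScalarTower k A (I l)]
  [∀ l, AddCommGroup (P l)] [∀ l, Module k (P l)]
  [∀ l, Module A (P l)] [∀ l, IsScalarTower k A (P l)]
variable {ι : ∀ l, L l →ₗ[A] I l} {p : ∀ l, P l →ₗ[A] L l}

/-- `Ext¹(L m, ∇ l) ≠ 0` implies `l < m`. -/
def ExtOrdered (k : Type u) [Field k] [Algebra k A] (ι : ∀ l, L l →ₗ[A] I l) : Prop :=
  ∀ (l m : Λ) (X : Type u) [AddCommGroup X] [Module k X] [Module A X] [IsScalarTower k A X]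
    (i : costandard ι l →ₗ[A] X) (q : X →ₗ[A] L m), Function.Injective i →
    Function.Surjective q → Function.Exact i q → (¬ ∃ s : L m →ₗ[A] X, q ∘ₗ s = LinearMap.id) →
    l < m

namespace SimpleSystem

variable (S : SimpleSystem ι p)
include S

/-- `F` is the lowest layer and `c'` counts the layers above it. A submodule `W` not inside `F` maps
nontrivially to one of those layers `∇ j ⊆ I j`, which exhibits `L j` as a factor of `W`. -/
theorem filtSub_costandard_cases {V : Type u} [AddCommGroup V] [Module A V] {c : Λ → ℕ}
    {U : Submodule A V} (h : FiltSub (fun l => costandard ι l) c U) :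
    (U = ⊥ ∧ c = 0) ∨ ∃ (m : Λ) (c' : Λ → ℕ) (F : Submodule A V),
      (∀ j, c' j ≤ c j) ∧ c' m < c m ∧ Nonempty (F ≃ₗ[A] costandard ι m) ∧
      ∀ W ≤ U, ¬ W ≤ F → ∃ j, c' j ≠ 0 ∧ Factor A I W j := by
  classical
  induction h with
  | bot => exact Or.inl ⟨rfl, rfl⟩
  | @step c U U' l g hU hle hg hk ih =>
    right
    rcases ih with ⟨rfl, rfl⟩ | ⟨m, c', F, h1, h2, h3, h4⟩
    · refine ⟨l, 0, U', by simp, by simp, ⟨LinearEquiv.ofBijective g ⟨?_, hg⟩⟩,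
        fun W hW hn => absurd hW hn⟩
      rw [injective_iff_map_eq_zero]
      intro x hx
      exact Subtype.ext ((Submodule.mem_bot A).1 ((hk x).1 hx))
    · refine ⟨m, c' + Pi.single l 1, F, fun j => add_le_add (h1 j) le_rfl,
        Nat.add_lt_add_right h2 _, h3, fun W hW hn => ?_⟩
      by_cases hWU : W ≤ U
      · obtain ⟨j, hj, hj'⟩ := h4 W hWU hn
        exact ⟨j, by simp [hj], hj'⟩
      · refine ⟨l, by simp, (costandard ι l).subtype ∘ₗ g ∘ₗ Submodule.inclusion hW,
          fun h0 => hWU fun x hx => (hk ⟨x, hW hx⟩).1 (Subtype.ext ?_)⟩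
        exact LinearMap.congr_fun h0 ⟨x, hx⟩

variable [IsAlgClosed k] [∀ l, FiniteDimensional k (L l)] [∀ l, FiniteDimensional k (I l)]
  [∀ l, FiniteDimensional k (P l)]

include k in
-- The lowest layer of `I l` must be `∇ l`, and all other labels are strictly above `l`. A submodule
-- that is not inside the lowest layer therefore has a factor above `l`.
theorem costandardAbsorbs_of_filtSub (h : ∀ l, ∃ c : Λ → ℕ,
      FiltSub (fun m => costandard ι m) c (⊤ : Submodule A (I l)) ∧ c l = 1 ∧
        ∀ m, c m ≠ 0 → l ≤ m) : CostandardAbsorbs ι := by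
  intro l U hU
  obtain ⟨c, hc, hcl, hcm⟩ := h l
  rcases S.filtSub_costandard_cases hc with ⟨h0, -⟩ | ⟨m, c', F, h1, h2, ⟨e⟩, h4⟩
  · exact absurd (le_bot_iff.1 (h0 ▸ le_top)) (S.costandard_ne_bot l)
  have hF : F ≠ ⊥ := by
    rintro rfl
    refine S.costandard_ne_bot m ((Submodule.eq_bot_iff _).2 fun x hx => ?_)
    have := congrArg e (Subsingleton.elim (e.symm ⟨x, hx⟩) 0)
    simpa using this
  -- `F` contains a copy of `L m`, but the only simple submodule of `I l` is `L l`.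
  obtain rfl : m = l := by
    let i : L m →ₗ[A] costandard ι m :=
      (ι m).codRestrict _ fun x => S.range_le_costandard m ⟨x, rfl⟩
    refine S.eq_of_hom_ne_zero (f := F.subtype ∘ₗ e.symm.toLinearMap ∘ₗ i) fun h0 => ?_
    have hi : i = 0 := LinearMap.ext fun x => e.symm.injective (F.subtype_injective
      ((LinearMap.congr_fun h0 x).trans (by simp)))
    refine (S.isAtom_range m).1 ((LinearMap.range_eq_bot).2 ?_)
    ext x
    exact congrArg Subtype.val (LinearMap.congr_fun hi x)
  have hFle : F ≤ costandard ι m := by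
    refine S.le_costandard (k := k) (S.range_le hF)
      (fun j hj => S.factor_costandard (k := k) ((factor_congr e).1 hj)) ?_
    rw [← S.finrank_costandard_self (k := k) m]
    exact LinearMap.finrank_le_finrank_of_injective
      (precomp_injective (k := k) (T := I m) e.symm.surjective)
  by_contra hn
  -- Multiplicity one is spent on `F`, so the label `j` of a higher layer differs from `m`, and
  -- hence `m < j`.
  obtain ⟨j, hj, hj'⟩ := h4 U le_top fun h => hn (h.trans hFle)
  have hjm : m ≠ j := by
    rintro rfl
    omega
  exact hU j hj' (lt_of_le_of_ne (hcm j (by have := h1 j; omega)) hjm)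

/-- If `U` is not inside `∇ l`, choose a simple submodule `L m` of `(U + ∇ l) / ∇ l`. Its preimage
`X` in `I l` is a nonsplit extension of `L m` by `∇ l`, so `m` is a factor of `U` above `l`. -/
theorem costandardAbsorbs_of_extOrdered (h : ExtOrdered k ι) : CostandardAbsorbs ι := by
  intro l U hU
  by_contra hn
  set Q := U.map (costandard ι l).mkQ with hQ
  have hQ0 : Q ≠ ⊥ := fun h0 => hn (by
    rwa [hQ, ← LinearMap.le_ker_iff_map, Submodule.ker_mkQ] at h0)
  have : Nontrivial Q := Submodule.nontrivial_iff_ne_bot.2 hQ0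
  obtain ⟨m, T, ⟨e⟩⟩ := S.exists_factor (k := k) (V := Q)
  refine hU m ?_ ?_
  · have hq : Function.Surjective ((costandard ι l).mkQ.restrict fun x (hx : x ∈ U) =>
        Submodule.mem_map_of_mem (p := U) hx) := by
      rintro ⟨_, x, hx, rfl⟩
      exact ⟨⟨x, hx⟩, rfl⟩
    exact factor_of_surjective hq (S.factor_of_injective T.subtype_injective
      ((factor_congr (U := T) e).2 (S.factor_simple_iff.2 rfl)))
  · let φ : L m →ₗ[A] I l ⧸ costandard ι l := Q.subtype ∘ₗ T.subtype ∘ₗ e.symm.toLinearMap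
    have hφ : Function.Injective φ :=
      Q.subtype_injective.comp (T.subtype_injective.comp e.symm.injective)
    let X : Submodule A (I l) := (LinearMap.range φ).comap (costandard ι l).mkQ
    let q : X →ₗ[A] L m := (LinearEquiv.ofInjective φ hφ).symm.toLinearMap ∘ₗ
      (costandard ι l).mkQ.restrict (p := X) (q := LinearMap.range φ) fun x hx => hx
    have hφq : ∀ x : X, φ (q x) = (costandard ι l).mkQ x := fun x =>
      LinearEquiv.ofInjective_symm_apply (f := φ) (h := hφ) ⟨(costandard ι l).mkQ x, x.2⟩
    have hle : costandard ι l ≤ X := fun x hx => by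
      have h0 : (costandard ι l).mkQ x = 0 := by simpa using hx
      rw [Submodule.mem_comap, h0]
      exact Submodule.zero_mem _
    have hq0 : ∀ x : X, q x = 0 ↔ (x : I l) ∈ costandard ι l := fun x => by
      rw [← map_eq_zero_iff φ hφ, hφq]
      simp
    refine h l m X (Submodule.inclusion hle) q (Submodule.inclusion_injective hle) ?_ ?_ ?_
    · intro y
      obtain ⟨x, hx⟩ := (costandard ι l).mkQ_surjective (φ y)
      exact ⟨⟨x, y, hx.symm⟩, hφ ((hφq _).trans hx)⟩
    · intro x
      rw [hq0]
      exact ⟨fun hx => ⟨⟨x, hx⟩, rfl⟩, fun ⟨y, hy⟩ => hy ▸ y.2⟩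
    -- The image of a section would contain the socle of `I l`; but the socle lies in `∇ l`, which
    -- `q` kills.
    · rintro ⟨s, hs⟩
      have hs' : ∀ y, q (s y) = y := fun y => LinearMap.congr_fun hs y
      have := S.simple m
      have := IsSimpleModule.nontrivial A (L m)
      have hne : LinearMap.range (X.subtype ∘ₗ s) ≠ ⊥ := by
        rw [Ne, LinearMap.range_eq_bot]
        intro h0
        obtain ⟨y, hy⟩ := exists_ne (0 : L m)
        have h1 : s y = 0 := Subtype.ext (LinearMap.congr_fun h0 y)
        exact hy (by rw [← hs' y, h1, map_zero])
      refine (S.isAtom_range l).1 ((Submodule.eq_bot_iff _).2 fun x hx => ?_)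
      obtain ⟨y, rfl⟩ := S.range_le hne hx
      have h1 : q (s y) = 0 := (hq0 _).2 (S.range_le_costandard l hx)
      rw [hs'] at h1
      rw [h1, map_zero]

/-- Extend the inclusion `∇ l → I l` to `φ : X → I l`. If `φ` is injective and `m` is not above `l`,
absorption pushes the image of `X` into `∇ l`, which is impossible. Otherwise the kernel of `φ`
meets `∇ l` trivially, maps isomorphically to `L m` and splits the sequence. -/
theorem extOrdered_of_costandardAbsorbs (hA : CostandardAbsorbs ι) : ExtOrdered k ι := by
  intro l m X _ _ _ _ i q hi hq hex hs
  by_contra hlm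
  have := S.simple m
  obtain ⟨φ, hφ⟩ := (S.injective l).out i hi (costandard ι l).subtype
  by_cases hinj : Function.Injective φ
  · have hr : LinearMap.range φ ≤ costandard ι l := hA l _ fun j hj hlj => by
      rcases factor_or_of_exact hq hex
        (factor_of_surjective φ.surjective_rangeRestrict hj) with h | h
      · exact (S.factor_costandard (k := k) h).not_gt hlj
      · exact hlm (S.factor_simple_iff.1 h ▸ hlj)
    have := IsSimpleModule.nontrivial A (L m)
    obtain ⟨y, hy⟩ := exists_ne (0 : L m)
    obtain ⟨x, rfl⟩ := hq y
    refine hy ((hex x).2 ⟨⟨φ x, hr ⟨x, rfl⟩⟩, hinj (hφ _)⟩)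
  · have hker : LinearMap.ker φ ≠ ⊥ := fun h => hinj (LinearMap.ker_eq_bot.1 h)
    have hqi : Function.Injective (q ∘ₗ (LinearMap.ker φ).subtype) := by
      rw [injective_iff_map_eq_zero]
      rintro ⟨x, hx⟩ h0
      obtain ⟨y, rfl⟩ := (hex x).1 h0
      have h1 : (y : I l) = 0 := (hφ y).symm.trans hx
      have : y = 0 := Subtype.ext h1
      simp [this]
    have hqs : Function.Surjective (q ∘ₗ (LinearMap.ker φ).subtype) := by
      refine (LinearMap.surjective_or_eq_zero _).resolve_right fun h0 => hker ?_
      rw [Submodule.eq_bot_iff]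
      intro x hx
      exact congrArg Subtype.val (hqi (a₁ := ⟨x, hx⟩) (a₂ := 0) (by rw [h0]; rfl))
    refine hs ⟨(LinearMap.ker φ).subtype ∘ₗ
      (LinearEquiv.ofBijective _ ⟨hqi, hqs⟩).symm.toLinearMap, ?_⟩
    ext y
    exact (LinearEquiv.ofBijective _ ⟨hqi, hqs⟩).apply_symm_apply y

include k in
theorem costandard_le_oSub (l : Λ) : costandard ι l ≤ oSub A I (Set.Iic l) (I l) :=
  le_oSub fun _ hm => S.factor_costandard (k := k) hm

include k in
theorem costandard_eq_oSub (hA : CostandardAbsorbs ι) (l : Λ) :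
    costandard ι l = oSub A I (Set.Iic l) (I l) :=
  le_antisymm (S.costandard_le_oSub (k := k) l)
    (hA l _ fun _ hm => (S.factor_oSub (π := Set.Iic l) hm).not_gt)

include k in
-- A nonzero non-injective endomorphism would have kernel and image both containing the socle `L l`,
-- contradicting `[∇ l : L l] = 1`.
theorem costandard_schurian {l : Λ} {f : costandard ι l →ₗ[A] costandard ι l} (hf : f ≠ 0) :
    Function.Injective f := by
  by_contra hinj
  have hker : LinearMap.ker f ≠ ⊥ := fun h => hinj (LinearMap.ker_eq_bot.1 h)
  have hex : Function.Exact (LinearMap.ker f).subtype f.rangeRestrict := by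
    intro x
    rw [← Subtype.coe_inj]
    change f x = 0 ↔ _
    exact ⟨fun hx => ⟨⟨x, hx⟩, rfl⟩, fun ⟨y, hy⟩ => hy ▸ y.2⟩
  have := S.injective l
  have h1 := finrank_hom_injective (k := k) (T := I l) (Submodule.subtype_injective _) hex
    f.surjective_rangeRestrict
  have key : ∀ U : Submodule A (costandard ι l), U ≠ ⊥ → Module.finrank k (U →ₗ[A] I l) ≠ 0 := by
    intro U hU
    refine factor_iff_finrank_ne_zero.1 ⟨(costandard ι l).subtype ∘ₗ U.subtype, fun h0 => hU ?_⟩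
    rw [Submodule.eq_bot_iff]
    intro x hx
    exact Subtype.ext (LinearMap.congr_fun h0 ⟨x, hx⟩)
  have h2 := key _ hker
  have h3 := key (LinearMap.range f) (by rwa [Ne, LinearMap.range_eq_bot])
  rw [S.finrank_costandard_self] at h1
  omega

include k in
-- If `L l` occurred twice in `∇_DR l`, there would be a nonzero map `∇_DR l / L l → I l`. Its image
-- again lies in `∇_DR l`, giving a nonzero endomorphism that kills the socle.
theorem oSub_eq_costandard_of_schurian (hS : ∀ l (f : oSub A I (Set.Iic l) (I l) →ₗ[A]
      oSub A I (Set.Iic l) (I l)), f ≠ 0 → Function.Injective f) (l : Λ) :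
    oSub A I (Set.Iic l) (I l) = costandard ι l := by
  have hle := S.costandard_le_oSub (k := k) l
  have hr := (S.range_le_costandard l).trans hle
  have hfac : ∀ m, Factor A I (oSub A I (Set.Iic l) (I l)) m → m ≤ l :=
    fun m hm => S.factor_oSub (π := Set.Iic l) hm
  refine le_antisymm (S.le_costandard (k := k) hr hfac ?_) hle
  rw [S.finrank_hom_of_range_le hr]
  by_contra hgt
  obtain ⟨g, hg⟩ := factor_iff_finrank_ne_zero.2
    (show Module.finrank k ((oSub A I (Set.Iic l) (I l)).map (LinearMap.range (ι l)).mkQ →ₗ[A]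
      I l) ≠ 0 by omega)
  let q := (LinearMap.range (ι l)).mkQ.restrict
    fun x (hx : x ∈ oSub A I (Set.Iic l) (I l)) => Submodule.mem_map_of_mem hx
  have hq : Function.Surjective q := by
    rintro ⟨_, x, hx, rfl⟩
    exact ⟨⟨x, hx⟩, rfl⟩
  have hrange : LinearMap.range (g ∘ₗ q) ≤ oSub A I (Set.Iic l) (I l) := le_oSub fun m hm =>
    hfac m (factor_of_surjective (g ∘ₗ q).surjective_rangeRestrict hm)
  have hinj := hS l ((g ∘ₗ q).codRestrict _ fun x => hrange ⟨x, rfl⟩) fun h0 => hg (by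
    have h1 : g ∘ₗ q = 0 := by
      ext x
      exact congrArg Subtype.val (LinearMap.congr_fun h0 x)
    exact (LinearMap.cancel_right hq).1 (h1.trans (LinearMap.zero_comp _).symm))
  refine (S.isAtom_range l).1 ((Submodule.eq_bot_iff _).2 fun x hx => ?_)
  refine congrArg Subtype.val (hinj (a₁ := ⟨x, hr hx⟩) (a₂ := 0) (Subtype.ext ?_))
  have hqx : q ⟨x, hr hx⟩ = 0 := Subtype.ext (by
    change (LinearMap.range (ι l)).mkQ x = 0
    simpa using hx)
  change g (q _) = g (q 0)
  rw [hqx]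
  exact congrArg g (map_zero q).symm

include k in
-- If a factor `m` of `U` were not below `l`, it would be incomparable with `l`. The image of `P m`
-- in `U` has top `L m` and socle `L l`, so adaptedness gives it a factor above `l`.
theorem costandardAbsorbs_of_adapted (hS : ∀ l, oSub A I (Set.Iic l) (I l) = costandard ι l)
    (hAd : ∀ (l m : Λ) (V : Submodule A (I l)) (g : P m →ₗ[A] V), Function.Surjective g →
      V ≠ ⊥ → ¬ m ≤ l → ¬ l ≤ m → ∃ j, l < j ∧ Factor A I V j) : CostandardAbsorbs ι := by
  intro l U hU
  rw [← hS l]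
  refine le_oSub fun m hm => ?_
  by_contra hml
  have hml : ¬ m ≤ l := hml
  obtain ⟨g, hg⟩ := (S.factor_iff_projective (k := k)).1 hm
  have hlm : ¬ l ≤ m := fun h => (lt_or_eq_of_le h).elim (hU m hm) fun h' => hml h'.ge
  have hV : LinearMap.range (U.subtype ∘ₗ g) ≠ ⊥ := by
    rw [Ne, LinearMap.range_eq_bot]
    exact fun h0 => hg ((LinearMap.cancel_left U.subtype_injective).1
      (h0.trans (LinearMap.comp_zero _).symm))
  obtain ⟨j, hj, hj'⟩ := hAd l m _ _ (U.subtype ∘ₗ g).surjective_rangeRestrict hV hml hlm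
  have hle : LinearMap.range (U.subtype ∘ₗ g) ≤ U := by
    rintro _ ⟨x, rfl⟩
    exact (g x).2
  exact hU j (S.factor_of_injective (Submodule.inclusion_injective hle) hj') hj

include k in
-- This is `Δ_D = Δ_DR`. The top of `Δ l` uses up its only occurrence of `L l`, so the image of the
-- maximal submodule of `P l` in `Δ l` has only factors strictly below `l`.
theorem map_oSup_eq_oSup [Finite Λ] (hA : CostandardAbsorbs ι) (l : Λ) :
    (oSup A I (Set.Iio l) (LinearMap.ker (p l))).map (LinearMap.ker (p l)).subtype =
      oSup A I (Set.Iic l) (P l) := by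
  have hle := S.oSup_Iic_le_ker l
  refine le_antisymm ?_ (oSup_le fun m hm => ?_)
  · rw [Submodule.map_le_iff_le_comap]
    refine oSup_le fun m hm => ?_
    set K := oSup A I (Set.Iic l) (P l) with hK
    let i := Submodule.mapQ (K.comap (LinearMap.ker (p l)).subtype) K (LinearMap.ker (p l)).subtype
      le_rfl
    have hi : Function.Injective i := by
      rw [← LinearMap.ker_eq_bot, Submodule.ker_mapQ, Submodule.mkQ_map_self]
    refine lt_of_le_of_ne (S.factor_standard (k := k) (S.factor_of_injective hi hm)) ?_
    rintro rfl
    let q : (P m ⧸ K) →ₗ[A] L m := K.liftQ (p m) hle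
    have hq : Function.Surjective q := fun y => by
      obtain ⟨x, rfl⟩ := S.p_surjective m y
      exact ⟨K.mkQ x, rfl⟩
    have hex : Function.Exact i q := by
      intro x
      obtain ⟨x, rfl⟩ := K.mkQ_surjective x
      constructor
      · intro hx
        exact ⟨Submodule.mkQ _ ⟨x, hx⟩, rfl⟩
      · rintro ⟨y, hy⟩
        obtain ⟨y, rfl⟩ := Submodule.mkQ_surjective _ y
        rw [← hy]
        exact y.2
    have := S.injective m
    have h1 := finrank_hom_injective (k := k) (T := I m) hi hex hq
    rw [S.finrank_simple_self, S.finrank_standard_self hA] at h1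
    exact (factor_iff_finrank_ne_zero (k := k)).1 hm (by omega)
  · obtain ⟨g, hg⟩ := (S.factor_quotient_iff (k := k)).1 hm
    -- A map `P m → P l` either stays in the maximal submodule or reaches the top, and then `m = l`.
    by_cases hgk : LinearMap.range g ≤ LinearMap.ker (p l)
    · have hfac : Factor A I (LinearMap.ker (p l) ⧸ oSup A I (Set.Iio l) (LinearMap.ker (p l))) m :=
        (S.factor_quotient_iff (k := k)).2
          ⟨g.codRestrict _ fun x => hgk ⟨x, rfl⟩, fun h => hg (by
            rintro _ ⟨x, rfl⟩
            exact ⟨_, h ⟨x, rfl⟩, rfl⟩)⟩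
      exact (S.factor_oSup (k := k) (π := Set.Iio l) hfac).le
    · rw [LinearMap.range_le_ker_iff] at hgk
      exact (S.eq_of_projective_hom_ne_zero hgk).le

/-! ### Filtration multiplicities, and passage from `C` to the injective hulls -/

section Multiplicities

variable [Fintype Λ] (hA : CostandardAbsorbs ι)
variable {V : Type u} [AddCommGroup V] [Module k V] [Module A V] [IsScalarTower k A V]
  [FiniteDimensional k V]

theorem finrank_hom_top {T : Type u} [AddCommGroup T] [Module k T] [Module A T]
    [IsScalarTower k A T] :
    Module.finrank k (T →ₗ[A] (⊤ : Submodule A V)) = Module.finrank k (T →ₗ[A] V) :=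
  (LinearEquiv.ofBijective _ ⟨postcomp_injective (k := k) (T := T)
    (Submodule.subtype_injective (⊤ : Submodule A V)), fun f =>
      ⟨f.codRestrict ⊤ fun _ => Submodule.mem_top, rfl⟩⟩).finrank_eq

theorem finrank_top_submodule :
    Module.finrank k (⊤ : Submodule A V) = Module.finrank k V :=
  (Submodule.topEquiv.restrictScalars k : (⊤ : Submodule A V) ≃ₗ[k] V).finrank_eq

include hA

theorem finrank_le_sum_standard : Module.finrank k V ≤
    ∑ m, Module.finrank k (Standard A I P m →ₗ[A] V) * Module.finrank k (costandard ι m) := by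
  have h := (S.finrank_le_and_filtSub (k := k) hA (⊤ : Submodule A V)).1
  simpa only [S.finrank_hom_top, S.finrank_top_submodule] using h

/-- The multiplicities of a filtration dominate the ranks of the Hom spaces, which supplies the
inequality opposite to `finrank_le_sum_standard`. -/
theorem exists_filtSub_iff : (∃ c, FiltSub (fun m => costandard ι m) c (⊤ : Submodule A V)) ↔
    Module.finrank k V = ∑ m, Module.finrank k (Standard A I P m →ₗ[A] V) *
      Module.finrank k (costandard ι m) := by
  constructor
  · rintro ⟨c, hc⟩
    refine le_antisymm (S.finrank_le_sum_standard hA) ?_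
    obtain ⟨h1, h2⟩ := S.finrank_of_filtSub (k := k) hc
    rw [S.finrank_top_submodule] at h2
    rw [h2]
    exact Finset.sum_le_sum fun m _ => Nat.mul_le_mul_right _ (S.finrank_hom_top.ge.trans (h1 m))
  · intro h
    refine (S.finrank_le_and_filtSub (k := k) hA (⊤ : Submodule A V)).2 ?_
    simpa only [S.finrank_hom_top, S.finrank_top_submodule] using h

/-- The termwise bounds add up to an equality with positive weights `dim (∇ m)`, so each of them is
an equality. -/
theorem filtSub_mult {c : Λ → ℕ} (hc : FiltSub (fun m => costandard ι m) c (⊤ : Submodule A V))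
    (m : Λ) : c m = Module.finrank k (Standard A I P m →ₗ[A] V) := by
  obtain ⟨h1, h2⟩ := S.finrank_of_filtSub (k := k) hc
  rw [S.finrank_top_submodule] at h2
  have h3 := (S.exists_filtSub_iff (k := k) hA).1 ⟨c, hc⟩
  rw [h2] at h3
  have h1' : ∀ m, Module.finrank k (Standard A I P m →ₗ[A] V) ≤ c m :=
    fun m => S.finrank_hom_top.ge.trans (h1 m)
  have h4 := (Finset.sum_eq_sum_iff_of_le fun m _ => Nat.mul_le_mul_right
    (Module.finrank k (costandard ι m)) (h1' m)).1 h3.symm m (Finset.mem_univ m)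
  have : Nontrivial (costandard ι m) := Submodule.nontrivial_iff_ne_bot.2 (S.costandard_ne_bot m)
  exact (Nat.eq_of_mul_eq_mul_right Module.finrank_pos h4).symm

include k in
-- Reciprocity: `∇ m` occurs `dim Hom(Δ m, I l) = [Δ m : L l]` times in `I l`.
theorem filtSub_injective_mult {l : Λ} {c : Λ → ℕ}
    (hc : FiltSub (fun m => costandard ι m) c (⊤ : Submodule A (I l))) :
    c l = 1 ∧ ∀ m, c m ≠ 0 → l ≤ m := by
  refine ⟨by rw [S.filtSub_mult (k := k) hA hc, S.finrank_standard_self hA], fun m hm => ?_⟩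
  rw [S.filtSub_mult (k := k) hA hc] at hm
  exact S.factor_standard (k := k) (factor_iff_finrank_ne_zero.2 hm)

omit hA in
/-- If `V` represents the dual space functor, then it has the dimension of the sum of the
injective hulls `I l`, each taken `dim (L l)` times. -/
theorem finrank_eq_sum_injective (hV : ∀ (W : Type u) [AddCommGroup W] [Module k W] [Module A W]
      [IsScalarTower k A W] [FiniteDimensional k W],
      Module.finrank k (W →ₗ[A] V) = Module.finrank k W) :
    Module.finrank k V = ∑ l, Module.finrank k (I l) * Module.finrank k (L l) := by
  -- First `[V : L m] = dim Hom(P m, V) = dim (P m)`; then the symmetry `[P m : L l] = [I l : L m]`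
  -- exchanges projectives and injectives.
  calc Module.finrank k V = ∑ m, Module.finrank k (P m) * Module.finrank k (L m) := by
        rw [S.finrank_eq_sum V]
        exact Finset.sum_congr rfl fun m _ => by rw [← S.finrank_projective_hom, hV]
    _ = ∑ m, ∑ l, Module.finrank k (P m →ₗ[A] I l) * Module.finrank k (L l) *
          Module.finrank k (L m) :=
        Finset.sum_congr rfl fun m _ => by rw [S.finrank_eq_sum (P m), Finset.sum_mul]
    _ = ∑ l, ∑ m, Module.finrank k (P m →ₗ[A] I l) * Module.finrank k (L l) *
          Module.finrank k (L m) := Finset.sum_comm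
    _ = _ := Finset.sum_congr rfl fun l _ => by
        rw [S.finrank_eq_sum (I l), Finset.sum_mul]
        refine Finset.sum_congr rfl fun m _ => ?_
        rw [S.finrank_projective_hom, mul_right_comm]

/-- The numerical criterion for `V` is the sum of those for the `I l`, weighted by `dim (L l) > 0`.
The inequality holds for each `l`, so equality of the sums is equality for every `l`. -/
theorem exists_filtSub_iff_forall (hV : ∀ (W : Type u) [AddCommGroup W] [Module k W] [Module A W]
      [IsScalarTower k A W] [FiniteDimensional k W],
      Module.finrank k (W →ₗ[A] V) = Module.finrank k W) :
    (∃ c, FiltSub (fun m => costandard ι m) c (⊤ : Submodule A V)) ↔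
      ∀ l, ∃ c, FiltSub (fun m => costandard ι m) c (⊤ : Submodule A (I l)) := by
  simp only [S.exists_filtSub_iff (k := k) hA]
  have hsum : ∑ m, Module.finrank k (Standard A I P m →ₗ[A] V) *
        Module.finrank k (costandard ι m) =
      ∑ l, (∑ m, Module.finrank k (Standard A I P m →ₗ[A] I l) *
        Module.finrank k (costandard ι m)) * Module.finrank k (L l) := by
    simp only [hV, Finset.sum_mul]
    rw [Finset.sum_comm]
    refine Finset.sum_congr rfl fun m _ => ?_
    rw [S.finrank_eq_sum (Standard A I P m), Finset.sum_mul]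
    exact Finset.sum_congr rfl fun l _ => mul_right_comm _ _ _
  rw [hsum, S.finrank_eq_sum_injective hV, Finset.sum_eq_sum_iff_of_le fun l _ =>
    Nat.mul_le_mul_right _ (S.finrank_le_sum_standard hA)]
  refine ⟨fun h l => ?_, fun h l _ => by rw [h l]⟩
  have := S.simple l
  have := IsSimpleModule.nontrivial A (L l)
  exact Nat.eq_of_mul_eq_mul_right Module.finrank_pos (h l (Finset.mem_univ l))

end Multiplicities

end SimpleSystem

end Characterization

/-! ### Comodules as modules over the dual algebra, and back -/

section DualAlgebra

variable (k C : Type u) [Field k] [AddCommGroup C] [Module k C] [Coalgebra k C]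

/-- The opposite of the convolution algebra of functionals on `C`; left `C`-comodules are left
modules over it. -/
def DualAlg : Type u := (WithConv (C →ₗ[k] k))ᵐᵒᵖ

noncomputable instance : Ring (DualAlg k C) := inferInstanceAs (Ring (WithConv (C →ₗ[k] k))ᵐᵒᵖ)

noncomputable instance : Algebra k (DualAlg k C) :=
  inferInstanceAs (Algebra k (WithConv (C →ₗ[k] k))ᵐᵒᵖ)

/-- The functional on `C` underlying an element of the dual algebra. -/
def DualAlg.functional : DualAlg k C ≃ₗ[k] (C →ₗ[k] k) :=
  (MulOpposite.opLinearEquiv k).symm.trans (WithConv.linearEquiv k (C →ₗ[k] k))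

instance [FiniteDimensional k C] : FiniteDimensional k (DualAlg k C) :=
  Module.Finite.equiv (DualAlg.functional k C).symm

variable {k C}

theorem DualAlg.functional_one : DualAlg.functional k C 1 = Coalgebra.counit := rfl

/-- The convolution product of two functionals. -/
noncomputable def conv (f g : C →ₗ[k] k) : C →ₗ[k] k :=
  LinearMap.mul' k k ∘ₗ TensorProduct.map f g ∘ₗ Coalgebra.comul

variable {V : Type u} [AddCommGroup V] [Module k V]

/-- Contraction of the first factor of `C ⊗ V` with a functional. -/
noncomputable def contractFst (V : Type u) [AddCommGroup V] [Module k V] (f : C →ₗ[k] k) :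
    C ⊗[k] V →ₗ[k] V :=
  (TensorProduct.lid k V).toLinearMap ∘ₗ f.rTensor V

@[simp]
theorem contractFst_tmul (f : C →ₗ[k] k) (c : C) (v : V) :
    contractFst V f (c ⊗ₜ v) = f c • v := by
  simp [contractFst]

theorem eq_of_contractFst {s t : C ⊗[k] V}
    (h : ∀ f : C →ₗ[k] k, contractFst V f s = contractFst V f t) : s = t := by
  let b := Module.Free.chooseBasis k C
  apply (TensorProduct.equivFinsuppOfBasisLeft (N := V) b).injective
  ext i
  rw [TensorProduct.equivFinsuppOfBasisLeft_apply, TensorProduct.equivFinsuppOfBasisLeft_apply]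
  exact h (b.coord i)

theorem contractFst_lTensor {W : Type u} [AddCommGroup W] [Module k W] (φ : V →ₗ[k] W)
    (f : C →ₗ[k] k) (t : C ⊗[k] V) :
    contractFst W f (φ.lTensor C t) = φ (contractFst V f t) := by
  induction t using TensorProduct.induction_on with
  | zero => simp
  | tmul c x => simp
  | add x y hx hy => simp only [map_add, hx, hy]

theorem contractFst_assoc (f g : C →ₗ[k] k) (t : C ⊗[k] V) :
    contractFst V g (contractFst (C ⊗[k] V) f (TensorProduct.assoc k C C V
      ((Coalgebra.comul (R := k) (A := C)).rTensor V t))) = contractFst V (conv f g) t := by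
  induction t using TensorProduct.induction_on with
  | zero => simp
  | tmul c x =>
    simp only [LinearMap.rTensor_tmul, contractFst_tmul, conv, LinearMap.comp_apply]
    generalize Coalgebra.comul (R := k) c = s
    induction s using TensorProduct.induction_on with
    | zero => simp
    | tmul a b => simp [mul_smul]
    | add x y hx hy => simp only [map_add, TensorProduct.add_tmul, add_smul, hx, hy]
  | add x y hx hy => simp only [map_add, hx, hy]

section Comodule

variable [LeftComodule k C V]

/-- The action of a functional on a comodule. -/
noncomputable def contract (V : Type u) [AddCommGroup V] [Module k V] [LeftComodule k C V]
    (f : C →ₗ[k] k) : V →ₗ[k] V :=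
  contractFst V f ∘ₗ coact k C V

theorem contract_counit (v : V) : contract V (Coalgebra.counit (R := k) (A := C)) v = v := by
  have h := LinearMap.congr_fun (LeftComodule.counit_coact (k := k) (C := C) (V := V)) v
  simp only [LinearMap.comp_apply] at h
  simp only [contract, contractFst, LinearMap.comp_apply]
  rw [h]
  simp

/-- Coassociativity composes contractions in reversed order, which is why the opposite of the
convolution algebra acts from the left. -/
theorem contract_contract (f g : C →ₗ[k] k) (v : V) :
    contract V g (contract V f v) = contract V (conv f g) v := by
  have h := LinearMap.congr_fun (LeftComodule.coassoc (k := k) (C := C) (V := V)) v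
  have h2 := congrArg (fun t => contractFst V g (contractFst (C ⊗[k] V) f t)) h
  simp only [LinearMap.comp_apply, LinearEquiv.coe_coe, contractFst_assoc,
    contractFst_lTensor] at h2
  exact h2.symm

noncomputable instance comodModule : Module (DualAlg k C) V where
  smul a v := contract V (DualAlg.functional k C a) v
  one_smul v := contract_counit v
  mul_smul a b v := (contract_contract _ _ v).symm
  smul_zero _ := map_zero _
  smul_add _ := map_add _
  add_smul a b v := by
    change contract V (DualAlg.functional k C (a + b)) v = contract V (DualAlg.functional k C a) v +
      contract V (DualAlg.functional k C b) v
    simp [contract, contractFst, LinearMap.rTensor_add]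
  zero_smul v := by
    change contract V (DualAlg.functional k C 0) v = 0
    simp [contract, contractFst]

theorem dualAlg_smul_def (a : DualAlg k C) (v : V) :
    a • v = contract V (DualAlg.functional k C a) v := rfl

instance : IsScalarTower k (DualAlg k C) V where
  smul_assoc c a v := by
    rw [dualAlg_smul_def, dualAlg_smul_def, map_smul]
    simp [contract, contractFst, LinearMap.rTensor_smul]

end Comodule

section OfModule

/-- A module over the dual algebra of a finite-dimensional coalgebra, viewed as a comodule. -/
def AsComod (_k _C V : Type u) : Type u := V

variable [FiniteDimensional k C] [Module (DualAlg k C) V] [IsScalarTower k (DualAlg k C) V]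

noncomputable instance : AddCommGroup (AsComod k C V) := inferInstanceAs (AddCommGroup V)
noncomputable instance : Module k (AsComod k C V) := inferInstanceAs (Module k V)

variable (k C V) in
/-- The coaction on a module over the dual algebra. -/
noncomputable def moduleCoact : V →ₗ[k] C ⊗[k] V :=
  ∑ i, TensorProduct.mk k C V (Module.finBasis k C i) ∘ₗ
    Module.toModuleEnd k (S := DualAlg k C) V
      ((DualAlg.functional k C).symm ((Module.finBasis k C).coord i))

theorem contractFst_moduleCoact (f : C →ₗ[k] k) (v : V) :
    contractFst V f (moduleCoact k C V v) = (DualAlg.functional k C).symm f • v := by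
  have hf : f = ∑ i, f (Module.finBasis k C i) • (Module.finBasis k C).coord i :=
    ((Module.finBasis k C).sum_dual_apply_smul_coord f).symm
  have hv : (DualAlg.functional k C).symm f • v = ∑ i, f (Module.finBasis k C i) •
      (DualAlg.functional k C).symm ((Module.finBasis k C).coord i) • v := by
    conv_lhs => rw [hf]
    simp only [map_sum, map_smul, Finset.sum_smul, smul_assoc]
  rw [hv]
  simp [moduleCoact, LinearMap.sum_apply, map_sum]

variable (k C V) in
/-- The comodule defined by a module over the dual algebra. -/
@[reducible]
noncomputable def moduleLeftComodule : LeftComodule k C V where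
  coact := moduleCoact k C V
  coassoc := by
    -- Contracting both copies of `C` turns coassociativity into associativity of the action.
    refine LinearMap.ext fun v => eq_of_contractFst fun f => eq_of_contractFst fun g => ?_
    simp only [LinearMap.comp_apply, LinearEquiv.coe_coe]
    rw [contractFst_assoc, contractFst_lTensor]
    simp only [contractFst_moduleCoact]
    rw [← mul_smul]
    congr 1
  counit_coact := by
    refine LinearMap.ext fun v => (TensorProduct.lid k V).injective ?_
    refine (contractFst_moduleCoact (Coalgebra.counit (R := k) (A := C)) v).trans ?_
    rw [← DualAlg.functional_one, LinearEquiv.symm_apply_apply, one_smul]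
    simp

noncomputable instance : LeftComodule k C (AsComod k C V) := moduleLeftComodule k C V

variable (k C V) in
/-- A module over the dual algebra is isomorphic to the module defined by its coaction. -/
noncomputable def asComodEquiv : V ≃ₗ[DualAlg k C] AsComod k C V where
  toFun v := v
  invFun v := v
  left_inv _ := rfl
  right_inv _ := rfl
  map_add' _ _ := rfl
  map_smul' a v := by
    refine Eq.trans ?_ (contractFst_moduleCoact (V := V) (DualAlg.functional k C a) v).symm
    rw [LinearEquiv.symm_apply_apply]

end OfModule

end DualAlgebra

/-! ### Homomorphisms, subcomodules and quotients under the translation -/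

section Dictionary

variable {k C : Type u} [Field k] [AddCommGroup C] [Module k C] [Coalgebra k C]
variable {V W N : Type u} [AddCommGroup V] [Module k V] [LeftComodule k C V]
  [AddCommGroup W] [Module k W] [LeftComodule k C W]
  [AddCommGroup N] [Module k N] [LeftComodule k C N]

/-- A homomorphism of comodules as a linear map over the dual algebra. -/
noncomputable def ComodHom.toLin (φ : ComodHom k C V W) : V →ₗ[DualAlg k C] W where
  toFun := φ.toLinearMap
  map_add' := map_add _
  map_smul' a v := (Subcomodule.hom_contract φ v (DualAlg.functional k C a)).symm

/-- A linear map over the dual algebra as a homomorphism of comodules. -/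
noncomputable def ComodHom.ofLin (φ : V →ₗ[DualAlg k C] W) : ComodHom k C V W where
  toLinearMap := φ.restrictScalars k
  map_coact := by
    refine LinearMap.ext fun v => eq_of_contractFst fun f => ?_
    simp only [LinearMap.comp_apply]
    rw [contractFst_lTensor]
    exact (φ.map_smul ((DualAlg.functional k C).symm f) v).symm

@[simp]
theorem ComodHom.toLin_apply (φ : ComodHom k C V W) (v : V) : φ.toLin v = φ.toLinearMap v := rfl

theorem isomorphic_iff : Isomorphic k C V W ↔ Nonempty (V ≃ₗ[DualAlg k C] W) := by
  constructor
  · rintro ⟨e, he⟩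
    exact ⟨LinearEquiv.ofBijective (ComodHom.toLin ⟨e.toLinearMap, he⟩) e.bijective⟩
  · rintro ⟨e⟩
    exact ⟨e.restrictScalars k, (ComodHom.ofLin e.toLinearMap).map_coact⟩

/-- A subcomodule as a submodule over the dual algebra. -/
noncomputable def Subcomodule.toSub (U : Subcomodule k C V) : Submodule (DualAlg k C) V where
  carrier := U.toSubmodule
  add_mem' := U.toSubmodule.add_mem
  zero_mem' := U.toSubmodule.zero_mem
  smul_mem' a _ hv := U.contract_mem hv (DualAlg.functional k C a)

/-- A submodule over the dual algebra as a subcomodule. -/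
noncomputable def Subcomodule.ofSub (U : Submodule (DualAlg k C) V) : Subcomodule k C V :=
  ofContract (U.restrictScalars k)
    fun _ hv f => U.smul_mem ((DualAlg.functional k C).symm f) hv

namespace Subcomodule

@[simp]
theorem toSub_ofSub (U : Submodule (DualAlg k C) V) : (ofSub U).toSub = U := rfl

theorem toSub_injective : Function.Injective (toSub (k := k) (C := C) (V := V)) := by
  intro U U' h
  ext v
  exact SetLike.ext_iff.1 h v

theorem toSub_eq_bot {U : Subcomodule k C V} : U.toSub = ⊥ ↔ U.toSubmodule = ⊥ := by
  rw [Submodule.eq_bot_iff, Submodule.eq_bot_iff]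
  rfl

theorem toSub_eq_top {U : Subcomodule k C V} : U.toSub = ⊤ ↔ U.toSubmodule = ⊤ := by
  rw [Submodule.eq_top_iff', Submodule.eq_top_iff']
  rfl

theorem toSub_sSup_le {S : Set (Subcomodule k C V)} {X : Submodule (DualAlg k C) V} :
    (Subcomodule.sSup S).toSub ≤ X ↔ ∀ U ∈ S, U.toSub ≤ X := by
  change (⨆ U ∈ S, U.toSubmodule) ≤ X.restrictScalars k ↔ _
  rw [iSup₂_le_iff]
  rfl

theorem le_toSub_sInf {S : Set (Subcomodule k C V)} {X : Submodule (DualAlg k C) V} :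
    X ≤ (Subcomodule.sInf S).toSub ↔ ∀ U ∈ S, X ≤ U.toSub := by
  change X.restrictScalars k ≤ (⨅ U ∈ S, U.toSubmodule) ↔ _
  rw [le_iInf₂_iff]
  rfl

theorem toSub_range (φ : ComodHom k C V W) :
    (Subcomodule.range φ).toSub = LinearMap.range φ.toLin := by
  ext v
  exact Iff.rfl

/-- The two module structures on a subcomodule agree. -/
noncomputable def subEquiv (U : Subcomodule k C V) : U.toSubmodule ≃ₗ[DualAlg k C] U.toSub where
  toFun x := ⟨x, x.2⟩
  invFun x := ⟨x, x.2⟩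
  left_inv _ := rfl
  right_inv _ := rfl
  map_add' _ _ := rfl
  map_smul' a x := Subtype.ext (U.incl.toLin.map_smul a x)

/-- Maps out of `V` with prescribed kernel replace isomorphisms of the quotient, so that the
quotient comodule need not be identified with a quotient over the dual algebra. -/
theorem quotient_equiv_iff (U : Subcomodule k C V) :
    Nonempty ((V ⧸ U.toSubmodule) ≃ₗ[DualAlg k C] N) ↔
      ∃ g : V →ₗ[DualAlg k C] N, Function.Surjective g ∧ ∀ v, g v = 0 ↔ v ∈ U.toSubmodule := by
  have hs : Function.Surjective U.proj.toLin := U.toSubmodule.mkQ_surjective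
  have hk : ∀ v, U.proj.toLin v = 0 ↔ v ∈ U.toSubmodule :=
    fun v => Submodule.Quotient.mk_eq_zero _
  constructor
  · rintro ⟨e⟩
    refine ⟨e.toLinearMap ∘ₗ U.proj.toLin, e.surjective.comp hs, fun v => ?_⟩
    rw [← hk]
    exact e.map_eq_zero_iff
  · rintro ⟨g, hg, hgk⟩
    obtain ⟨g', rfl⟩ := exists_comp_eq_of_ker_le hs (g := g)
      fun v hv => (hgk v).2 ((hk v).1 hv)
    refine ⟨LinearEquiv.ofBijective g' ⟨?_, fun y => ?_⟩⟩
    · rw [injective_iff_map_eq_zero]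
      intro x hx
      obtain ⟨v, rfl⟩ := hs x
      exact (hk v).2 ((hgk v).1 hx)
    · obtain ⟨v, rfl⟩ := hg y
      exact ⟨_, rfl⟩

theorem subquotient_equiv_iff (U₁ U₂ : Subcomodule k C V) :
    Nonempty (Subquotient U₁ U₂ ≃ₗ[DualAlg k C] N) ↔
      ∃ g : U₂.toSub →ₗ[DualAlg k C] N, Function.Surjective g ∧
        ∀ x, g x = 0 ↔ (x : V) ∈ U₁.toSub := by
  refine (quotient_equiv_iff (comap U₂.incl U₁)).trans ⟨?_, ?_⟩
  · rintro ⟨g, hg, hk⟩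
    exact ⟨g ∘ₗ U₂.subEquiv.symm.toLinearMap, hg.comp U₂.subEquiv.symm.surjective,
      fun x => hk (U₂.subEquiv.symm x)⟩
  · rintro ⟨g, hg, hk⟩
    exact ⟨g ∘ₗ U₂.subEquiv.toLinearMap, hg.comp U₂.subEquiv.surjective,
      fun x => hk (U₂.subEquiv x)⟩

theorem exists_quotEquiv (U : Subcomodule k C V) : ∃ e : (V ⧸ U.toSubmodule) ≃ₗ[DualAlg k C]
    (V ⧸ U.toSub), ∀ v, e (U.toSubmodule.mkQ v) = U.toSub.mkQ v := by
  have hs : Function.Surjective U.proj.toLin := U.toSubmodule.mkQ_surjective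
  have hk : ∀ v, U.proj.toLin v = 0 ↔ v ∈ U.toSubmodule :=
    fun v => Submodule.Quotient.mk_eq_zero _
  obtain ⟨g, hg⟩ := exists_comp_eq_of_ker_le hs (g := U.toSub.mkQ)
    fun v hv => (Submodule.Quotient.mk_eq_zero _).2 ((hk v).1 hv)
  have hg' : ∀ v, g (U.proj.toLin v) = U.toSub.mkQ v := fun v => LinearMap.congr_fun hg v
  refine ⟨LinearEquiv.ofBijective g ⟨?_, fun y => ?_⟩, hg'⟩
  · rw [injective_iff_map_eq_zero]
    intro x hx
    obtain ⟨v, rfl⟩ := hs x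
    rw [hg'] at hx
    exact (hk v).2 ((Submodule.Quotient.mk_eq_zero _).1 hx)
  · obtain ⟨v, rfl⟩ := U.toSub.mkQ_surjective y
    exact ⟨_, hg' v⟩

end Subcomodule

end Dictionary

/-! ### The simple system of a coalgebra and its finiteness -/

section Systems

variable {k C : Type u} [Field k] [AddCommGroup C] [Module k C] [Coalgebra k C]
variable {V W : Type u} [AddCommGroup V] [Module k V] [LeftComodule k C V]
  [AddCommGroup W] [Module k W] [LeftComodule k C W]

theorem isSimple_iff : IsSimple k C V ↔ IsSimpleModule (DualAlg k C) V := by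
  rw [isSimpleModule_iff, isSimpleOrder_iff, IsSimple, Submodule.nontrivial_iff]
  refine and_congr_right fun _ => ⟨fun h U => ?_, fun h U => ?_⟩
  · have := h (Subcomodule.ofSub U)
    rwa [← Subcomodule.toSub_eq_bot, ← Subcomodule.toSub_eq_top] at this
  · rw [← Subcomodule.toSub_eq_bot, ← Subcomodule.toSub_eq_top]
    exact h U.toSub

theorem conv_apply_eq (f h : C →ₗ[k] k) (c : C) : h (contract C f c) = conv f h c := by
  simp only [contract, contractFst, conv, LinearMap.comp_apply]
  change h (TensorProduct.lid k C (f.rTensor C (Coalgebra.comul c))) = _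
  generalize Coalgebra.comul (R := k) c = s
  induction s using TensorProduct.induction_on with
  | zero => simp
  | tmul a b => simp
  | add x y hx hy => simp only [map_add, hx, hy]

/-- The comodule homomorphism `V → C` defined by a functional on `V`. -/
noncomputable def coextend (φ : V →ₗ[k] k) : V →ₗ[k] C :=
  (TensorProduct.rid k C).toLinearMap ∘ₗ φ.lTensor C ∘ₗ coact k C V

theorem functional_coextend (φ : V →ₗ[k] k) (h : C →ₗ[k] k) (v : V) :
    h (coextend φ v) = φ (contract V h v) := by
  simp only [coextend, contract, contractFst, LinearMap.comp_apply]
  generalize coact k C V v = s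
  induction s using TensorProduct.induction_on with
  | zero => simp
  | tmul a b => simp [mul_comm]
  | add x y hx hy => simp only [map_add, hx, hy]

/-- `coextend` as a linear map over the dual algebra. -/
noncomputable def coextendLin (φ : V →ₗ[k] k) : V →ₗ[DualAlg k C] C where
  toFun := coextend φ
  map_add' := map_add _
  map_smul' a v := by
    rw [← sub_eq_zero, ← Module.forall_dual_apply_eq_zero_iff k]
    intro h
    rw [map_sub, sub_eq_zero, functional_coextend, RingHom.id_apply, dualAlg_smul_def,
      dualAlg_smul_def, contract_contract, ← functional_coextend, conv_apply_eq]

theorem counit_coextendLin (φ : V →ₗ[k] k) (v : V) :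
    Coalgebra.counit (R := k) (coextendLin (C := C) φ v) = φ v := by
  change Coalgebra.counit (R := k) (coextend (C := C) φ v) = φ v
  rw [functional_coextend, contract_counit]

theorem conv_counit (f : C →ₗ[k] k) : conv f (Coalgebra.counit (R := k)) = f := by
  have h := mul_one (WithConv.toConv f)
  exact congrArg WithConv.ofConv h

/-- Homomorphisms to `C` correspond to functionals. -/
theorem finrank_hom_self : Module.finrank k (V →ₗ[DualAlg k C] C) = Module.finrank k V := by
  let T : (V →ₗ[DualAlg k C] C) →ₗ[k] (V →ₗ[k] k) :=
    { toFun := fun g => Coalgebra.counit ∘ₗ g.restrictScalars k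
      map_add' := fun g h => by ext; simp
      map_smul' := fun c g => by ext; simp }
  have hT : Function.Bijective T := by
    refine ⟨?_, fun φ => ⟨coextendLin φ, LinearMap.ext fun v => counit_coextendLin φ v⟩⟩
    -- If the counit kills the image of `g`, then `f (g v) = ε (f • g v) = ε (g (f • v)) = 0` for
    -- every functional `f`.
    rw [injective_iff_map_eq_zero]
    intro g hg
    ext v
    rw [LinearMap.zero_apply, ← Module.forall_dual_apply_eq_zero_iff k]
    intro f
    have h1 := LinearMap.congr_fun hg ((DualAlg.functional k C).symm f • v)
    have h2 : Coalgebra.counit (R := k) (g ((DualAlg.functional k C).symm f • v)) = 0 := h1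
    rwa [map_smul, dualAlg_smul_def, conv_apply_eq, conv_counit,
      LinearEquiv.apply_symm_apply] at h2
  rw [(LinearEquiv.ofBijective T hT).finrank_eq]
  exact Subspace.dual_finrank_eq

variable [FiniteDimensional k C]

theorem finrank_module_hom_self (W : Type u) [AddCommGroup W] [Module k W]
    [Module (DualAlg k C) W] [IsScalarTower k (DualAlg k C) W] :
    Module.finrank k (W →ₗ[DualAlg k C] C) = Module.finrank k W := by
  have h := finrank_hom_self (k := k) (C := C) (V := AsComod k C W)
  have e : (AsComod k C W →ₗ[DualAlg k C] C) ≃ₗ[k] (W →ₗ[DualAlg k C] C) :=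
    LinearEquiv.ofBijective (precomp k C (asComodEquiv k C W).toLinearMap)
      ⟨precomp_injective (asComodEquiv k C W).surjective, fun g =>
        ⟨g ∘ₗ (asComodEquiv k C W).symm.toLinearMap, rfl⟩⟩
  rw [← e.finrank_eq, h]
  rfl

/-- Every test diagram of modules becomes a diagram of comodules through `AsComod`. -/
theorem injective_of_isInjective (h : IsInjective k C V) : Module.Injective (DualAlg k C) V := by
  constructor
  intro X Y _ _ _ _ f hf g
  let _ : Module k X := Module.compHom X (algebraMap k (DualAlg k C))
  let _ : Module k Y := Module.compHom Y (algebraMap k (DualAlg k C))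
  have : IsScalarTower k (DualAlg k C) X := ⟨fun c a x => by
    rw [Algebra.smul_def, mul_smul]; rfl⟩
  have : IsScalarTower k (DualAlg k C) Y := ⟨fun c a x => by
    rw [Algebra.smul_def, mul_smul]; rfl⟩
  let eX := asComodEquiv k C X
  let eY := asComodEquiv k C Y
  obtain ⟨h', hh'⟩ := h (AsComod k C X) (AsComod k C Y)
    (ComodHom.ofLin (eY.toLinearMap ∘ₗ f ∘ₗ eX.symm.toLinearMap))
    (ComodHom.ofLin (g ∘ₗ eX.symm.toLinearMap))
    (eY.injective.comp (hf.comp eX.symm.injective))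
  refine ⟨h'.toLin ∘ₗ eY.toLinearMap, fun x => ?_⟩
  exact LinearMap.congr_fun hh' (eX x)

theorem projective_of_isProjective (h : IsProjective k C V) :
    Module.Projective (DualAlg k C) V := by
  refine Module.Projective.of_lifting_property'' fun f hf => ?_
  let X := V →₀ DualAlg k C
  let eX := asComodEquiv k C X
  obtain ⟨h', hh'⟩ := h (AsComod k C X) V
    (ComodHom.ofLin (f ∘ₗ eX.symm.toLinearMap)) (ComodHom.ofLin LinearMap.id)
    (hf.comp eX.symm.surjective)
  exact ⟨eX.symm.toLinearMap ∘ₗ h'.toLin, LinearMap.ext fun x => LinearMap.congr_fun hh' x⟩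

variable {Λ : Type w}
variable {L : Λ → Type u} [∀ l, AddCommGroup (L l)] [∀ l, Module k (L l)]
  [∀ l, LeftComodule k C (L l)]
  {I : Λ → Type u} [∀ l, AddCommGroup (I l)] [∀ l, Module k (I l)]
  [∀ l, LeftComodule k C (I l)] {ι : ∀ l, ComodHom k C (L l) (I l)}
  {P : Λ → Type u} [∀ l, AddCommGroup (P l)] [∀ l, Module k (P l)]
  [∀ l, LeftComodule k C (P l)] {p : ∀ l, ComodHom k C (P l) (L l)}

theorem simpleSystem_of_comodules (hL : IsCompleteSetOfSimples k C L)
    (hI : ∀ l, IsInjectiveHull (ι l)) (hP : ∀ l, IsProjectiveCover (p l)) :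
    SimpleSystem (fun l => (ι l).toLin) (fun l => (p l).toLin) where
  simple l := isSimple_iff.1 (hL.1 l)
  eq_of_equiv l m h := hL.2.1 l m (isomorphic_iff.2 h)
  complete S _ _ hS := by
    let _ : Module k S := Module.compHom S (algebraMap k (DualAlg k C))
    have : IsScalarTower k (DualAlg k C) S := ⟨fun c a x => by
      rw [Algebra.smul_def, mul_smul]; rfl⟩
    let e := asComodEquiv k C S
    obtain ⟨l, hl⟩ := hL.2.2 (AsComod k C S) (isSimple_iff.2 (IsSimpleModule.congr e.symm))
    obtain ⟨e'⟩ := isomorphic_iff.1 hl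
    exact ⟨l, ⟨e.trans e'⟩⟩
  injective l := injective_of_isInjective (hI l).1
  ι_injective l := (hI l).2.1
  essential l U hU := by
    have h := (hI l).2.2 (Subcomodule.ofSub U) (by
      rw [eq_bot_iff]
      intro x hx
      have : x ∈ U ⊓ LinearMap.range (ι l).toLin := hx
      rwa [hU] at this)
    rwa [← Subcomodule.toSub_eq_bot] at h
  projective l := projective_of_isProjective (hP l).1
  p_surjective l := (hP l).2.1
  superfluous l U hU := by
    have h := (hP l).2.2 (Subcomodule.ofSub U) (by
      rw [eq_top_iff]
      intro x _
      have : x ∈ U ⊔ LinearMap.ker (p l).toLin := hU ▸ Submodule.mem_top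
      obtain ⟨y, hy, z, hz, rfl⟩ := Submodule.mem_sup.1 this
      exact Submodule.add_mem_sup hy hz)
    rwa [← Subcomodule.toSub_eq_top] at h

variable (S : SimpleSystem (fun l => (ι l).toLin) (fun l => (p l).toLin))
include S

/-- Any element outside the kernel of `p l` generates `P l`, so `P l` is cyclic over a
finite-dimensional algebra. -/
theorem finiteDimensional_projective (l : Λ) : FiniteDimensional k (P l) := by
  have := S.simple l
  have := IsSimpleModule.nontrivial (DualAlg k C) (L l)
  obtain ⟨y, hy⟩ := exists_ne (0 : L l)
  obtain ⟨x, rfl⟩ := S.p_surjective l y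
  have htop := S.eq_top_of_not_le (U := Submodule.span (DualAlg k C) {x})
    fun h => hy (h (Submodule.mem_span_singleton_self x))
  have : Module.Finite (DualAlg k C) (P l) := ⟨htop ▸ Submodule.fg_span_singleton x⟩
  exact Module.Finite.trans (DualAlg k C) (P l)

theorem finiteDimensional_simple (l : Λ) : FiniteDimensional k (L l) := by
  have := finiteDimensional_projective S l
  exact Module.Finite.of_surjective (p l).toLinearMap (S.p_surjective l)

/-- A functional that is nonzero on the socle extends to a homomorphism `I l → C`, which is
injective because its kernel misses part of the socle. -/
theorem finiteDimensional_injective (l : Λ) : FiniteDimensional k (I l) := by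
  have := S.simple l
  have := IsSimpleModule.nontrivial (DualAlg k C) (L l)
  obtain ⟨y, hy⟩ := exists_ne (0 : L l)
  have hy' : (ι l).toLin y ≠ 0 := fun h => hy (S.ι_injective l (h.trans (map_zero _).symm))
  obtain ⟨φ, hφ⟩ : ∃ φ : I l →ₗ[k] k, φ ((ι l).toLin y) ≠ 0 := by
    by_contra h
    push Not at h
    exact hy' ((Module.forall_dual_apply_eq_zero_iff k _).1 h)
  have hinj : Function.Injective (coextendLin (C := C) φ) := by
    rw [← LinearMap.ker_eq_bot]
    by_contra h
    have h1 : coextendLin (C := C) φ ((ι l).toLin y) = 0 := S.range_le h ⟨y, rfl⟩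
    exact hφ (by rw [← counit_coextendLin (C := C) φ, h1, map_zero])
  exact FiniteDimensional.of_injective ((coextendLin (C := C) φ).restrictScalars k) hinj

theorem factor_self (l : Λ) : Factor (DualAlg k C) I C l := by
  have := S.simple l
  have := IsSimpleModule.nontrivial (DualAlg k C) (L l)
  obtain ⟨y, hy⟩ := exists_ne (0 : L l)
  obtain ⟨φ, hφ⟩ : ∃ φ : L l →ₗ[k] k, φ y ≠ 0 := by
    by_contra h
    push Not at h
    exact hy ((Module.forall_dual_apply_eq_zero_iff k _).1 h)
  have hinj := (LinearMap.injective_or_eq_zero (coextendLin (C := C) φ)).resolve_right fun h =>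
    hφ (by rw [← counit_coextendLin (C := C) φ, h, LinearMap.zero_apply, map_zero])
  exact S.factor_of_injective hinj (S.factor_simple_iff.2 rfl)

/-- Every `L l` embeds in `C`, which has finitely many composition factors. -/
theorem finite_index : Finite Λ := by
  have := finiteDimensional_simple S
  have h := S.finite_factors (k := k) C
  rw [Set.eq_univ_of_forall (s := {l | Factor (DualAlg k C) I C l}) (factor_self S)] at h
  exact Set.finite_univ_iff.1 h

end Systems

/-! ### Filtrations of comodules and of modules -/

section FiltrationTransfer

variable {k C : Type u} [Field k] [AddCommGroup C] [Module k C] [Coalgebra k C] {Λ : Type w}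
variable {V : Type u} [AddCommGroup V] [Module k V] [LeftComodule k C V]

theorem FiltSub.congr {A : Type u} [Ring A] {N N' : Λ → Type u} [∀ l, AddCommGroup (N l)]
    [∀ l, Module A (N l)] [∀ l, AddCommGroup (N' l)] [∀ l, Module A (N' l)]
    (e : ∀ l, N l ≃ₗ[A] N' l) {V : Type u} [AddCommGroup V] [Module A V] {c : Λ → ℕ}
    {U : Submodule A V} (h : FiltSub N c U) : FiltSub N' c U := by
  induction h with
  | bot => exact .bot
  | step l g hU hle hg hk ih =>
    exact .step l ((e l).toLinearMap ∘ₗ g) ih hle ((e l).surjective.comp hg)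
      fun x => by rw [← hk]; exact (e l).map_eq_zero_iff

variable {N : Λ → Type u} [∀ l, AddCommGroup (N l)] [∀ l, Module k (N l)]
  [∀ l, LeftComodule k C (N l)]

open scoped Classical in
theorem Filtration.filtSub_initial_segment (𝓕 : Filtration k C N V) (i : ℕ) (hi : i < 𝓕.n + 1) :
    FiltSub (A := DualAlg k C) N
      (∑ j ∈ Finset.univ.filter (fun j : Fin 𝓕.n => (j : ℕ) < i), Pi.single (𝓕.label j) 1)
      (𝓕.F ⟨i, hi⟩).toSub := by
  induction i with
  | zero =>
    have h : (𝓕.F ⟨0, hi⟩).toSub = ⊥ := Subcomodule.toSub_eq_bot.2 𝓕.F_zero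
    rw [h]
    simpa using FiltSub.bot
  | succ i ih =>
    have hi' : i < 𝓕.n := by omega
    have hf : Finset.univ.filter (fun j : Fin 𝓕.n => (j : ℕ) < i + 1) =
        insert ⟨i, hi'⟩ (Finset.univ.filter (fun j : Fin 𝓕.n => (j : ℕ) < i)) := by
      ext j
      simp only [Finset.mem_filter, Finset.mem_univ, true_and, Finset.mem_insert, Fin.ext_iff]
      omega
    rw [hf, Finset.sum_insert (by simp), add_comm]
    obtain ⟨g, hg, hk⟩ := (Subcomodule.subquotient_equiv_iff (N := N (𝓕.label ⟨i, hi'⟩)) _ _).1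
      (isomorphic_iff.1 (𝓕.F_iso ⟨i, hi'⟩))
    exact FiltSub.step (N := N) (𝓕.label ⟨i, hi'⟩) g (ih (by omega)) (𝓕.F_le ⟨i, hi'⟩) hg hk

theorem Filtration.filtSub (𝓕 : Filtration k C N V) :
    FiltSub N 𝓕.count (⊤ : Submodule (DualAlg k C) V) := by
  classical
  have h := 𝓕.filtSub_initial_segment 𝓕.n (by omega)
  have h1 : (𝓕.F ⟨𝓕.n, by omega⟩).toSub = ⊤ := Subcomodule.toSub_eq_top.2 𝓕.F_last
  rw [h1] at h
  convert h using 1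
  ext l
  rw [Filtration.count, Nat.card_eq_fintype_card, Fintype.card_subtype]
  simp only [Fin.is_lt, Finset.filter_true, Finset.sum_apply, Pi.single_apply, Finset.card_filter]
  exact Finset.sum_congr rfl fun j _ => by simp only [eq_comm]

/-- Indexing the chain by `ℕ` lets a layer be appended without changing the index type;
`hasFiltration_of_filtSub` restricts it to `Fin`. -/
theorem exists_chain_of_filtSub {c : Λ → ℕ} {U : Submodule (DualAlg k C) V}
    (h : FiltSub N c U) : ∃ (n : ℕ) (F : ℕ → Subcomodule k C V), (F 0).toSub = ⊥ ∧
      (F n).toSub = U ∧ ∀ i < n, (F i).toSubmodule ≤ (F (i + 1)).toSubmodule ∧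
        ∃ l, Isomorphic k C (Subcomodule.Subquotient (F i) (F (i + 1))) (N l) := by
  induction h with
  | bot => exact ⟨0, fun _ => Subcomodule.ofSub ⊥, rfl, rfl, fun i hi => by omega⟩
  | @step c U U' l g hU hle hg hk ih =>
    obtain ⟨n, F, h0, hn, hF⟩ := ih
    let F' : ℕ → Subcomodule k C V := fun i => if i ≤ n then F i else Subcomodule.ofSub U'
    have h1 : ∀ i ≤ n, F' i = F i := fun i hi => if_pos hi
    have h2 : F' (n + 1) = Subcomodule.ofSub U' := if_neg (by omega)
    refine ⟨n + 1, F', by rw [h1 0 (Nat.zero_le n), h0], by rw [h2, Subcomodule.toSub_ofSub],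
      fun i hi => ?_⟩
    rcases Nat.lt_succ_iff_lt_or_eq.1 hi with hlt | rfl
    · rw [h1 i hlt.le, h1 (i + 1) hlt]
      exact hF i hlt
    · rw [h1 i le_rfl, h2]
      refine ⟨fun x hx => hle ?_, l, isomorphic_iff.2
        ((Subcomodule.subquotient_equiv_iff _ _).2 ⟨g, hg, fun x => ?_⟩)⟩
      · rw [← hn]
        exact hx
      · rw [hn]
        exact hk x

theorem hasFiltration_of_filtSub {c : Λ → ℕ}
    (h : FiltSub N c (⊤ : Submodule (DualAlg k C) V)) : HasFiltration k C N V := by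
  obtain ⟨n, F, h0, hn, hF⟩ := exists_chain_of_filtSub h
  choose hle l hl using hF
  exact ⟨{
    n := n
    F := fun i => F i
    label := fun i => l i i.2
    F_zero := Subcomodule.toSub_eq_bot.1 h0
    F_last := Subcomodule.toSub_eq_top.1 hn
    F_le := fun i => hle i i.2
    F_iso := fun i => hl i i.2 }⟩

end FiltrationTransfer

/-! ### Composition factors, truncations and `Ext¹` under the translation -/

section Transfer

variable {k C : Type u} [Field k] [AddCommGroup C] [Module k C] [Coalgebra k C]
variable {Λ : Type w} [PartialOrder Λ]
variable {L : Λ → Type u} [∀ l, AddCommGroup (L l)] [∀ l, Module k (L l)]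
  [∀ l, LeftComodule k C (L l)]
  {I : Λ → Type u} [∀ l, AddCommGroup (I l)] [∀ l, Module k (I l)]
  [∀ l, LeftComodule k C (I l)] {ι : ∀ l, ComodHom k C (L l) (I l)}
  {P : Λ → Type u} [∀ l, AddCommGroup (P l)] [∀ l, Module k (P l)]
  [∀ l, LeftComodule k C (P l)] {p : ∀ l, ComodHom k C (P l) (L l)}

theorem mem_oSub_of_equiv {A : Type u} [Ring A] {I : Λ → Type u} [∀ l, AddCommGroup (I l)]
    [∀ l, Module A (I l)] {V W : Type u} [AddCommGroup V] [Module A V] [AddCommGroup W]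
    [Module A W] (e : V ≃ₗ[A] W) {π : Set Λ} {x : V} (hx : x ∈ oSub A I π V) :
    e x ∈ oSub A I π W := by
  have h : oSub A I π V ≤ (oSub A I π W).comap e.toLinearMap := sSup_le fun U hU => by
    rw [← Submodule.map_le_iff_le_comap]
    exact le_oSub fun m hm => hU m ((factor_congr (e.submoduleMap U)).2 hm)
  exact h hx

theorem mem_oSub_equiv_iff {A : Type u} [Ring A] {I : Λ → Type u} [∀ l, AddCommGroup (I l)]
    [∀ l, Module A (I l)] {V W : Type u} [AddCommGroup V] [Module A V] [AddCommGroup W]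
    [Module A W] (e : V ≃ₗ[A] W) {π : Set Λ} {x : V} :
    e x ∈ oSub A I π W ↔ x ∈ oSub A I π V :=
  ⟨fun h => by simpa using mem_oSub_of_equiv e.symm h, mem_oSub_of_equiv e⟩

theorem mem_oSup_of_equiv {A : Type u} [Ring A] {I : Λ → Type u} [∀ l, AddCommGroup (I l)]
    [∀ l, Module A (I l)] {V W : Type u} [AddCommGroup V] [Module A V] [AddCommGroup W]
    [Module A W] (e : V ≃ₗ[A] W) {π : Set Λ} {x : V} (hx : x ∈ oSup A I π V) :
    e x ∈ oSup A I π W := by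
  have h : oSup A I π V ≤ (oSup A I π W).comap e.toLinearMap := by
    rw [← Submodule.map_le_iff_le_comap]
    refine le_sInf fun U hU => ?_
    rw [Submodule.map_le_iff_le_comap]
    refine oSup_le fun m hm => hU m ((factor_congr (Submodule.Quotient.equiv _ U e ?_)).1 hm)
    exact Submodule.map_comap_eq_of_surjective e.surjective U
  exact h hx

theorem mem_oSup_equiv_iff {A : Type u} [Ring A] {I : Λ → Type u} [∀ l, AddCommGroup (I l)]
    [∀ l, Module A (I l)] {V W : Type u} [AddCommGroup V] [Module A V] [AddCommGroup W]
    [Module A W] (e : V ≃ₗ[A] W) {π : Set Λ} {x : V} :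
    e x ∈ oSup A I π W ↔ x ∈ oSup A I π V :=
  ⟨fun h => by simpa using mem_oSup_of_equiv e.symm h, mem_oSup_of_equiv e⟩

variable (S : SimpleSystem (fun l => (ι l).toLin) (fun l => (p l).toLin))
include S

variable {V : Type u} [AddCommGroup V] [Module k V] [LeftComodule k C V]

/-- A nonzero `f : V → I l` has the socle `L l` in its image, and the preimage of the socle modulo
the kernel of `f` is a copy of `L l`. The converse extends a map from a subquotient by injectivity
of `I l`. -/
theorem isCompositionFactor_iff {l : Λ} :
    IsCompositionFactor k C V (L l) ↔ Factor (DualAlg k C) I V l := by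
  constructor
  · rintro ⟨-, U₁, U₂, hle, hiso⟩
    obtain ⟨g, hg, hk⟩ := (Subcomodule.subquotient_equiv_iff _ _).1 (isomorphic_iff.1 hiso)
    exact S.factor_of_injective U₂.toSub.subtype_injective
      (factor_of_surjective hg (S.factor_simple_iff.2 rfl))
  · rintro ⟨f, hf⟩
    refine ⟨isSimple_iff.2 (S.simple l), Subcomodule.ofSub (LinearMap.ker f),
      Subcomodule.ofSub ((LinearMap.range (ι l).toLin).comap f), ?_, isomorphic_iff.2
        ((Subcomodule.subquotient_equiv_iff _ _).2 ?_)⟩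
    · intro x hx
      change f x ∈ LinearMap.range (ι l).toLin
      rw [show f x = 0 from hx]
      exact Submodule.zero_mem _
    · let e := LinearEquiv.ofInjective (ι l).toLin (S.ι_injective l)
      let r : ((LinearMap.range (ι l).toLin).comap f) →ₗ[DualAlg k C]
          LinearMap.range (ι l).toLin := f.restrict fun x hx => hx
      have hr : Function.Surjective r := by
        rintro ⟨y, hy⟩
        have hf' : LinearMap.range f ≠ ⊥ := by rwa [Ne, LinearMap.range_eq_bot]
        obtain ⟨x, rfl⟩ := S.range_le hf' hy
        exact ⟨⟨x, hy⟩, rfl⟩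
      refine ⟨e.symm.toLinearMap ∘ₗ r, e.symm.surjective.comp hr, fun x => ?_⟩
      refine (e.symm.map_eq_zero_iff (x := r x)).trans ?_
      rw [← Subtype.coe_inj]
      exact Iff.rfl

theorem belongsTo_iff {π : Set Λ} :
    BelongsTo k C L π V ↔ ∀ m, Factor (DualAlg k C) I V m → m ∈ π :=
  forall_congr' fun _ => imp_congr_left (isCompositionFactor_iff S)

theorem toSub_OSub (π : Set Λ) : (OSub k C L π V).toSub = oSub (DualAlg k C) I π V := by
  refine le_antisymm (Subcomodule.toSub_sSup_le.2 fun U hU => ?_) (sSup_le fun U hU => ?_)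
  · exact le_oSub fun m hm => (belongsTo_iff S).1 hU m ((factor_congr U.subEquiv).2 hm)
  · refine Subcomodule.toSub_sSup_le.1 le_rfl (Subcomodule.ofSub U) ((belongsTo_iff S).2 ?_)
    exact fun m hm => hU m ((factor_congr (Subcomodule.ofSub U).subEquiv).1 hm)

theorem toSub_OSup (π : Set Λ) : (OSup k C L π V).toSub = oSup (DualAlg k C) I π V := by
  refine le_antisymm (le_sInf fun U hU => ?_) (Subcomodule.le_toSub_sInf.2 fun U hU => ?_)
  · refine Subcomodule.le_toSub_sInf.1 le_rfl (Subcomodule.ofSub U) ((belongsTo_iff S).2 ?_)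
    obtain ⟨e, -⟩ := (Subcomodule.ofSub U).exists_quotEquiv
    exact fun m hm => hU m ((factor_congr e).1 hm)
  · obtain ⟨e, -⟩ := U.exists_quotEquiv
    exact oSup_le fun m hm => (belongsTo_iff S).1 hU m ((factor_congr e).2 hm)

theorem toSub_map_OSup (M : Subcomodule k C V) (π : Set Λ) :
    (Subcomodule.map M.incl (OSup k C L π M.toSubmodule)).toSub =
      (oSup (DualAlg k C) I π M.toSub).map M.toSub.subtype := by
  have h := fun x : M.toSubmodule => (SetLike.ext_iff.1 (toSub_OSup S π) x).trans
    (mem_oSup_equiv_iff M.subEquiv).symm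
  ext x
  constructor
  · rintro ⟨y, hy, rfl⟩
    exact ⟨M.subEquiv y, (h y).1 hy, rfl⟩
  · rintro ⟨y, hy, rfl⟩
    exact ⟨M.subEquiv.symm y, (h _).2 (by rwa [LinearEquiv.apply_symm_apply]), rfl⟩

theorem toSub_maxStrict (l : Λ) :
    (maxStrict k C (P l)).toSub = LinearMap.ker (p l).toLin := by
  refine le_antisymm (Subcomodule.toSub_sSup_le.2 fun U hU => ?_) ?_
  · by_contra h
    exact hU (Subcomodule.toSub_eq_top.1 (S.eq_top_of_not_le h))
  · refine Subcomodule.toSub_sSup_le.1 le_rfl (Subcomodule.ofSub (LinearMap.ker (p l).toLin)) ?_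
    intro h
    have := S.simple l
    rw [← Subcomodule.toSub_eq_top] at h
    exact (LinearMap.isCoatom_ker_of_surjective (S.p_surjective l)).1 h

theorem toSub_nablaD (l : Λ) :
    (nablaD L ι l).toSub = costandard (fun l => (ι l).toLin) l := by
  obtain ⟨e, he⟩ := (Subcomodule.range (ι l)).exists_quotEquiv
  ext x
  rw [costandard, ← Subcomodule.toSub_range, Submodule.mem_comap, ← he, mem_oSub_equiv_iff]
  exact SetLike.ext_iff.1 (toSub_OSub S (Set.Iio l)) _

theorem toSub_nablaDR (l : Λ) :
    (nablaDR k C L I l).toSub = oSub (DualAlg k C) I (Set.Iic l) (I l) :=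
  toSub_OSub S (Set.Iic l)

theorem toSub_kerDeltaDR (l : Λ) :
    (kerDeltaDR k C L P l).toSub = oSup (DualAlg k C) I (Set.Iic l) (P l) :=
  toSub_OSup S (Set.Iic l)

theorem toSub_kerDeltaD (l : Λ) :
    (kerDeltaD k C L P l).toSub = (oSup (DualAlg k C) I (Set.Iio l)
      (LinearMap.ker (p l).toLin)).map (LinearMap.ker (p l).toLin).subtype := by
  rw [← toSub_maxStrict S l]
  exact toSub_map_OSup S _ _

/-- The costandard comodule, as a module over the dual algebra. -/
noncomputable def nablaDEquiv (l : Λ) : (nablaD L ι l).toSubmodule ≃ₗ[DualAlg k C]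
    costandard (fun l => (ι l).toLin) l :=
  (nablaD L ι l).subEquiv.trans (LinearEquiv.ofEq _ _ (toSub_nablaD S l))

theorem filtSub_of_filtration
    (𝓕 : Filtration k C (fun m => (nablaD L ι m).toSubmodule) V) :
    FiltSub (fun m => costandard (fun l => (ι l).toLin) m) 𝓕.count
      (⊤ : Submodule (DualAlg k C) V) :=
  𝓕.filtSub.congr (nablaDEquiv S)

theorem hasFiltration_iff : HasFiltration k C (fun m => (nablaD L ι m).toSubmodule) V ↔
    ∃ c, FiltSub (fun m => costandard (fun l => (ι l).toLin) m) c
      (⊤ : Submodule (DualAlg k C) V) :=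
  ⟨fun ⟨𝓕⟩ => ⟨_, filtSub_of_filtration S 𝓕⟩, fun ⟨_, h⟩ =>
    hasFiltration_of_filtSub (h.congr fun l => (nablaDEquiv S l).symm)⟩

theorem extOrdered_iff [FiniteDimensional k C] : ExtOrdered k (fun l => (ι l).toLin) ↔
    ∀ l m, ExtOneNeZero k C (L m) (nablaD L ι l).toSubmodule → l < m := by
  constructor
  · rintro h l m ⟨X, _, _, _, i, q, hi, hq, hex, hs⟩
    refine h l m X (i.toLin ∘ₗ (nablaDEquiv S l).symm.toLinearMap) q.toLin
      (hi.comp (nablaDEquiv S l).symm.injective) hq (fun x => ?_) ?_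
    · have h1 : x ∈ LinearMap.range i.toLinearMap ↔ x ∈ LinearMap.ker q.toLinearMap := by
        rw [hex]
      refine h1.symm.trans ⟨?_, ?_⟩
      · rintro ⟨y, rfl⟩
        exact ⟨nablaDEquiv S l y, by simp⟩
      · rintro ⟨y, rfl⟩
        exact ⟨_, rfl⟩
    · rintro ⟨s, hs'⟩
      exact hs ⟨ComodHom.ofLin s, LinearMap.ext fun x => LinearMap.congr_fun hs' x⟩
  · intro h l m X _ _ _ _ i q hi hq hex hs
    let e := asComodEquiv k C X
    refine h l m ⟨AsComod k C X, inferInstance, inferInstance, inferInstance,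
      ComodHom.ofLin (e.toLinearMap ∘ₗ i ∘ₗ (nablaDEquiv S l).toLinearMap),
      ComodHom.ofLin (q ∘ₗ e.symm.toLinearMap), ?_, ?_, ?_, ?_⟩
    · exact e.injective.comp (hi.comp (nablaDEquiv S l).injective)
    · exact hq.comp e.symm.surjective
    · ext x
      refine Iff.trans ?_ (hex x).symm
      constructor
      · rintro ⟨y, rfl⟩
        exact ⟨nablaDEquiv S l y, rfl⟩
      · rintro ⟨y, hy⟩
        refine ⟨(nablaDEquiv S l).symm y, ?_⟩
        change i (nablaDEquiv S l ((nablaDEquiv S l).symm y)) = x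
        rw [LinearEquiv.apply_symm_apply, hy]
    · rintro ⟨s, hs'⟩
      exact hs ⟨e.symm.toLinearMap ∘ₗ s.toLin, LinearMap.ext fun x => LinearMap.congr_fun hs' x⟩

end Transfer

/-! ### Adaptedness, Schurian costandards and the two definitions -/

section QuasiHereditaryTransfer

variable {k C : Type u} [Field k] [AddCommGroup C] [Module k C] [Coalgebra k C]
variable {Λ : Type w} [PartialOrder Λ]
variable {L : Λ → Type u} [∀ l, AddCommGroup (L l)] [∀ l, Module k (L l)]
  [∀ l, LeftComodule k C (L l)]
  {I : Λ → Type u} [∀ l, AddCommGroup (I l)] [∀ l, Module k (I l)]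
  [∀ l, LeftComodule k C (I l)] {ι : ∀ l, ComodHom k C (L l) (I l)}
  {P : Λ → Type u} [∀ l, AddCommGroup (P l)] [∀ l, Module k (P l)]
  [∀ l, LeftComodule k C (P l)] {p : ∀ l, ComodHom k C (P l) (L l)}
  (S : SimpleSystem (fun l => (ι l).toLin) (fun l => (p l).toLin))
include S

variable {V : Type u} [AddCommGroup V] [Module k V] [LeftComodule k C V]

/-- Every simple submodule of `V` is carried into the socle `L l` of `I l`, so `V` has exactly one.
-/
theorem socle_equiv {l : Λ} [Nontrivial V] {f : V →ₗ[DualAlg k C] I l}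
    (hf : Function.Injective f) : Isomorphic k C (socle k C V).toSubmodule (L l) := by
  have hne : LinearMap.range f ≠ ⊥ := by
    rw [Ne, LinearMap.range_eq_bot]
    rintro rfl
    obtain ⟨x, hx⟩ := exists_ne (0 : V)
    exact hx (hf rfl)
  have hr := S.range_le hne
  let s : L l →ₗ[DualAlg k C] V := (LinearEquiv.ofInjective f hf).symm.toLinearMap ∘ₗ
    (ι l).toLin.codRestrict (LinearMap.range f) fun x => hr ⟨x, rfl⟩
  have hfs : ∀ x, f (s x) = (ι l).toLin x := fun x =>
    LinearEquiv.ofInjective_symm_apply (f := f) (h := hf) ⟨_, hr ⟨x, rfl⟩⟩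
  have hs : Function.Injective s := fun x y h => S.ι_injective l (by rw [← hfs, ← hfs, h])
  have hsoc : (socle k C V).toSub = LinearMap.range s := by
    refine le_antisymm (Subcomodule.toSub_sSup_le.2 fun U hU => ?_) ?_
    · have : IsSimpleModule (DualAlg k C) U.toSub :=
        @IsSimpleModule.congr _ _ _ _ _ _ _ _ U.subEquiv.symm (isSimple_iff.1 hU)
      intro x hx
      obtain ⟨y, hy⟩ := S.range_le_of_simple (f ∘ₗ U.toSub.subtype) ⟨⟨x, hx⟩, rfl⟩
      exact ⟨y, hf ((hfs y).trans hy)⟩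
    · refine Subcomodule.toSub_sSup_le.1 le_rfl (Subcomodule.ofSub (LinearMap.range s)) ?_
      have := S.simple l
      exact isSimple_iff.2 (IsSimpleModule.congr
        ((Subcomodule.ofSub (LinearMap.range s)).subEquiv.trans
          (LinearEquiv.ofInjective s hs).symm))
  exact isomorphic_iff.2 ⟨(socle k C V).subEquiv.trans
    ((LinearEquiv.ofEq _ _ hsoc).trans (LinearEquiv.ofInjective s hs).symm)⟩

theorem top_equiv {l : Λ} [Nontrivial V] {g : P l →ₗ[DualAlg k C] V}
    (hg : Function.Surjective g) :
    Isomorphic k C (V ⧸ (radical k C V).toSubmodule) (L l) := by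
  have := S.simple l
  have hker : LinearMap.ker g ≤ LinearMap.ker (p l).toLin := by
    by_contra h
    obtain ⟨x, hx⟩ := exists_ne (0 : V)
    obtain ⟨y, rfl⟩ := hg x
    have hy : y ∈ LinearMap.ker g := S.eq_top_of_not_le h ▸ Submodule.mem_top
    exact hx hy
  obtain ⟨r, hr⟩ := exists_comp_eq_of_ker_le hg hker
  have hr' : ∀ x, r (g x) = (p l).toLin x := fun x => LinearMap.congr_fun hr x
  have hrs : Function.Surjective r := fun y => by
    obtain ⟨x, rfl⟩ := S.p_surjective l y
    exact ⟨g x, hr' x⟩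
  have hrad : (radical k C V).toSub = LinearMap.ker r := by
    refine le_antisymm ?_ (Subcomodule.le_toSub_sInf.2 fun U hU => ?_)
    · refine Subcomodule.le_toSub_sInf.1 le_rfl (Subcomodule.ofSub (LinearMap.ker r)) ?_
      obtain ⟨e⟩ := (Subcomodule.quotient_equiv_iff (N := L l)
        (Subcomodule.ofSub (LinearMap.ker r))).2 ⟨r, hrs, fun v => Iff.rfl⟩
      exact isSimple_iff.2 (IsSimpleModule.congr e)
    · have := isSimple_iff.1 hU
      intro x hx
      obtain ⟨y, rfl⟩ := hg x
      have hy : y ∈ LinearMap.ker (p l).toLin := (hr' y).symm.trans hx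
      have := S.ker_le_of_simple (U.proj.toLin ∘ₗ g) hy
      exact (Submodule.Quotient.mk_eq_zero _).1 this
  refine isomorphic_iff.2 ((Subcomodule.quotient_equiv_iff _).2 ⟨r, hrs, fun v => ?_⟩)
  exact (SetLike.ext_iff.1 hrad v).symm

/-- Nakayama's argument: the projection of `P l` to the top lifts to `V`, and its image together
with the radical is everything, so no maximal submodule contains it. -/
theorem exists_surjective_of_top_equiv [FiniteDimensional k V] {l : Λ}
    (h : Isomorphic k C (V ⧸ (radical k C V).toSubmodule) (L l)) :
    ∃ g : P l →ₗ[DualAlg k C] V, Function.Surjective g := by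
  obtain ⟨e⟩ := isomorphic_iff.1 h
  have := S.projective l
  obtain ⟨g, hg⟩ := Module.projective_lifting_property (radical k C V).proj.toLin
    (e.symm.toLinearMap ∘ₗ (p l).toLin) (radical k C V).toSubmodule.mkQ_surjective
  refine ⟨g, LinearMap.range_eq_top.1 ?_⟩
  have : IsNoetherian (DualAlg k C) V := isNoetherian_of_tower k inferInstance
  rcases IsCoatomic.eq_top_or_exists_le_coatom (LinearMap.range g) with h | ⟨M, hM, hgM⟩
  · exact h
  · exfalso
    refine hM.1 (Submodule.eq_top_iff'.2 fun x => ?_)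
    obtain ⟨y, hy⟩ : ∃ y, (p l).toLin y = e ((radical k C V).proj.toLin x) :=
      S.p_surjective l _
    have h1 : (radical k C V).proj.toLin (g y) = (radical k C V).proj.toLin x :=
      (LinearMap.congr_fun hg y).trans
        ((congrArg e.symm hy).trans (e.symm_apply_apply _))
    have h2 : x - g y ∈ (radical k C V).toSub :=
      (Submodule.Quotient.eq _).1 h1.symm
    have h3 : (radical k C V).toSub ≤ M := by
      refine Subcomodule.le_toSub_sInf.1 le_rfl (Subcomodule.ofSub M) ?_
      obtain ⟨e', -⟩ := (Subcomodule.ofSub M).exists_quotEquiv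
      have hs : IsSimpleModule (DualAlg k C) (V ⧸ M) := isSimpleModule_iff_isCoatom.2 hM
      exact isSimple_iff.2 (@IsSimpleModule.congr _ _ _ _ _ _ _ _ e' hs)
    have h4 := M.add_mem (h3 h2) (hgM ⟨y, rfl⟩)
    rwa [sub_add_cancel] at h4

variable [IsAlgClosed k] [FiniteDimensional k C] [∀ l, FiniteDimensional k (L l)]
  [∀ l, FiniteDimensional k (I l)] [∀ l, FiniteDimensional k (P l)]

theorem isAdapted_of_costandardAbsorbs [Finite Λ]
    (hA : CostandardAbsorbs (fun l => (ι l).toLin)) : IsAdapted k C L := by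
  intro V _ _ _ _ l₁ l₂ htop hsoc h12 h21
  obtain ⟨g, hg⟩ := exists_surjective_of_top_equiv S htop
  obtain ⟨e⟩ := isomorphic_iff.1 hsoc
  have hfac : Factor (DualAlg k C) I V l₂ :=
    S.factor_of_injective (f := (socle k C V).incl.toLin)
      (socle k C V).toSubmodule.subtype_injective
      ((factor_congr e).2 (S.factor_simple_iff.2 rfl))
  obtain ⟨m, h1, h2, h3⟩ := S.exists_factor_gt hA (k := k) hg hfac h21
  refine ⟨m, h1, lt_of_le_of_ne h2 ?_, (isCompositionFactor_iff S).2 h3⟩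
  rintro rfl
  exact h12 h1.le

theorem exists_factor_of_isAdapted (h : IsAdapted k C L) (l m : Λ)
    (V : Submodule (DualAlg k C) (I l)) (g : P m →ₗ[DualAlg k C] V)
    (hg : Function.Surjective g) (hV : V ≠ ⊥) (hml : ¬ m ≤ l) (hlm : ¬ l ≤ m) :
    ∃ j, l < j ∧ Factor (DualAlg k C) I V j := by
  let W := Subcomodule.ofSub V
  let e : W.toSubmodule ≃ₗ[DualAlg k C] V := W.subEquiv
  have : Nontrivial V := Submodule.nontrivial_iff_ne_bot.2 hV
  have hnt : Nontrivial W.toSubmodule := e.toEquiv.nontrivial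
  have hfin : FiniteDimensional k W.toSubmodule :=
    Module.Finite.equiv (e.restrictScalars k).symm
  obtain ⟨j, -, h2, h3⟩ := h W.toSubmodule m l
    (top_equiv S (g := e.symm.toLinearMap ∘ₗ g) (e.symm.surjective.comp hg))
    (socle_equiv S (f := V.subtype ∘ₗ e.toLinearMap) (V.subtype_injective.comp e.injective))
    hml hlm
  exact ⟨j, h2, (factor_congr e).1 ((isCompositionFactor_iff S).1 h3)⟩

theorem costandardAbsorbs_of_isDonkinQH (h : IsDonkinQH L ι) :
    CostandardAbsorbs (fun l => (ι l).toLin) := by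
  refine S.costandardAbsorbs_of_filtSub (k := k) fun l => ?_
  obtain ⟨h1, h2, h3⟩ := h l
  -- `filtMult` counts in a chosen filtration, so the same choice has to be transferred.
  have hm : ∀ m, filtMult k C (fun m => (nablaD L ι m).toSubmodule) (I l) m =
      (Classical.choice h1).count m := fun m => dif_pos h1
  refine ⟨_, filtSub_of_filtration S (Classical.choice h1), by rw [← hm, h2], fun m hm' => ?_⟩
  exact h3 m (by rwa [hm])

/-- Under absorption the multiplicity conditions are automatic, so only the existence of filtrations
of the `I l` remains, and this is a condition on `C` alone. -/
theorem isDonkinQH_iff [Fintype Λ] (hA : CostandardAbsorbs (fun l => (ι l).toLin)) :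
    IsDonkinQH L ι ↔ HasFiltration k C (fun m => (nablaD L ι m).toSubmodule) C := by
  rw [hasFiltration_iff S, S.exists_filtSub_iff_forall (k := k) hA
    fun W _ _ _ _ _ => finrank_module_hom_self W]
  refine forall_congr' fun l => ⟨fun h => (hasFiltration_iff S).1 h.1, fun h => ?_⟩
  have h1 := (hasFiltration_iff S).2 h
  have hm : ∀ m, filtMult k C (fun m => (nablaD L ι m).toSubmodule) (I l) m =
      (Classical.choice h1).count m := fun m => dif_pos h1
  have h2 := S.filtSub_injective_mult (k := k) hA
    (filtSub_of_filtration S (Classical.choice h1))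
  exact ⟨h1, by rw [hm, h2.1], fun m hm' => h2.2 m (by rwa [hm] at hm')⟩

theorem nablaD_eq_nablaDR (hA : CostandardAbsorbs (fun l => (ι l).toLin)) (l : Λ) :
    nablaD L ι l = nablaDR k C L I l :=
  Subcomodule.toSub_injective (by
    rw [toSub_nablaD S, toSub_nablaDR S, S.costandard_eq_oSub (k := k) hA])

theorem kerDeltaD_eq_kerDeltaDR [Finite Λ] (hA : CostandardAbsorbs (fun l => (ι l).toLin))
    (l : Λ) : kerDeltaD k C L P l = kerDeltaDR k C L P l :=
  Subcomodule.toSub_injective (by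
    rw [toSub_kerDeltaD S, toSub_kerDeltaDR S, S.map_oSup_eq_oSup (k := k) hA])

/-- Nonzero endomorphisms are injective by `costandard_schurian`, hence bijective by finite
dimension. -/
theorem isSchurian_nablaD (l : Λ) : IsSchurian k C (nablaD L ι l).toSubmodule := by
  let e := nablaDEquiv S l
  refine ⟨?_, fun f hf => ?_⟩
  · have := Submodule.nontrivial_iff_ne_bot.2 (S.costandard_ne_bot l)
    exact e.toEquiv.nontrivial
  · have hinj : Function.Injective f.toLin := by
      have h := S.costandard_schurian (k := k) (l := l)
        (f := e.toLinearMap ∘ₗ f.toLin ∘ₗ e.symm.toLinearMap) fun h0 => hf (by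
          ext x : 1
          apply e.injective
          have := LinearMap.congr_fun h0 (e x)
          simpa using this)
      have h' := h.comp e.injective
      intro x y hxy
      exact h' (by simp [hxy])
    have : FiniteDimensional k (nablaD L ι l).toSubmodule :=
      Module.Finite.equiv (e.restrictScalars k).symm
    have hsurj : Function.Surjective f.toLin :=
      (LinearMap.injective_iff_surjective (f := f.toLinearMap)).1 hinj
    let E := LinearEquiv.ofBijective f.toLin ⟨hinj, hsurj⟩
    exact ⟨ComodHom.ofLin E.symm.toLinearMap, LinearMap.ext fun x => E.apply_symm_apply x,
      LinearMap.ext fun x => E.symm_apply_apply x⟩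

theorem oSub_injective_of_isSchurian (l : Λ)
    (h : IsSchurian k C (nablaDR k C L I l).toSubmodule)
    (f : oSub (DualAlg k C) I (Set.Iic l) (I l) →ₗ[DualAlg k C]
      oSub (DualAlg k C) I (Set.Iic l) (I l)) (hf : f ≠ 0) : Function.Injective f := by
  let e := (nablaDR k C L I l).subEquiv.trans (LinearEquiv.ofEq _ _ (toSub_nablaDR S l))
  obtain ⟨g, -, hg⟩ := h.2 (ComodHom.ofLin (e.symm.toLinearMap ∘ₗ f ∘ₗ e.toLinearMap))
    fun h0 => hf (by
      ext x : 1
      have := LinearMap.congr_fun h0 (e.symm x)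
      have h1 : e.symm (f (e (e.symm x))) = 0 := this
      rwa [LinearEquiv.apply_symm_apply, e.symm.map_eq_zero_iff] at h1)
  rw [injective_iff_map_eq_zero]
  intro x hx
  have h1 : g.toLinearMap (e.symm (f (e (e.symm x)))) = e.symm x :=
    LinearMap.congr_fun hg (e.symm x)
  rw [LinearEquiv.apply_symm_apply, hx, map_zero, map_zero] at h1
  exact e.symm.map_eq_zero_iff.1 h1.symm

theorem costandardAbsorbs_of_isDlabRingelQH (h : IsDlabRingelQH k C L I) :
    CostandardAbsorbs (fun l => (ι l).toLin) :=
  S.costandardAbsorbs_of_adapted (k := k)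
    (S.oSub_eq_costandard_of_schurian (k := k)
      fun l => oSub_injective_of_isSchurian S l (h.2.1 l))
    (exists_factor_of_isAdapted S h.1)

theorem isDlabRingelQH_iff [Finite Λ] (hA : CostandardAbsorbs (fun l => (ι l).toLin)) :
    IsDlabRingelQH k C L I ↔
      HasFiltration k C (fun m => (nablaD L ι m).toSubmodule) C := by
  have h : nablaDR k C L I = nablaD L ι := funext fun l => (nablaD_eq_nablaDR S hA l).symm
  rw [IsDlabRingelQH, h]
  exact ⟨fun h => h.2.2, fun h => ⟨isAdapted_of_costandardAbsorbs S hA, isSchurian_nablaD S, h⟩⟩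

end QuasiHereditaryTransfer

end QHCoalg

theorem mainTheorem8 {k C : Type u} [Field k] [IsAlgClosed k]
    [AddCommGroup C] [Module k C] [Coalgebra k C] [FiniteDimensional k C]
    {Λ : Type w} [PartialOrder Λ]
    (L : Λ → Type u) [∀ l, AddCommGroup (L l)] [∀ l, Module k (L l)]
    [∀ l, LeftComodule k C (L l)] (hL : QHCoalg.IsCompleteSetOfSimples k C L)
    (I : Λ → Type u) [∀ l, AddCommGroup (I l)] [∀ l, Module k (I l)]
    [∀ l, LeftComodule k C (I l)] (ι : ∀ l, QHCoalg.ComodHom k C (L l) (I l))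
    (hI : ∀ l, QHCoalg.IsInjectiveHull (ι l))
    (P : Λ → Type u) [∀ l, AddCommGroup (P l)] [∀ l, Module k (P l)]
    [∀ l, LeftComodule k C (P l)] (p : ∀ l, QHCoalg.ComodHom k C (P l) (L l))
    (hP : ∀ l, QHCoalg.IsProjectiveCover (p l)) :
    (QHCoalg.IsDonkinQH L ι ↔ QHCoalg.IsDlabRingelQH k C L I) ∧
    (QHCoalg.IsDonkinQH L ι → ∀ l,
      QHCoalg.nablaD L ι l = QHCoalg.nablaDR k C L I l ∧
      QHCoalg.kerDeltaD k C L P l = QHCoalg.kerDeltaDR k C L P l) ∧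
    (QHCoalg.IsDonkinQH L ι ↔
      QHCoalg.HasFiltration k C (fun l => (QHCoalg.nablaD L ι l).toSubmodule) C ∧
      ∀ l m, QHCoalg.ExtOneNeZero k C (L m) (QHCoalg.nablaD L ι l).toSubmodule → l < m) := by
  have S := QHCoalg.simpleSystem_of_comodules hL hI hP
  have hLf := QHCoalg.finiteDimensional_simple S
  have hIf := QHCoalg.finiteDimensional_injective S
  have hPf := QHCoalg.finiteDimensional_projective S
  have := QHCoalg.finite_index S
  have := Fintype.ofFinite Λ
  -- Each implication first extracts absorption from its own hypothesis; after that, both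
  -- definitions say that `C` is filtered by the `∇_D`.
  refine ⟨⟨fun h => ?_, fun h => ?_⟩, fun h l => ?_, fun h => ?_, fun ⟨h1, h2⟩ => ?_⟩
  · have hA := QHCoalg.costandardAbsorbs_of_isDonkinQH S h
    exact (QHCoalg.isDlabRingelQH_iff S hA).2 ((QHCoalg.isDonkinQH_iff S hA).1 h)
  · have hA := QHCoalg.costandardAbsorbs_of_isDlabRingelQH S h
    exact (QHCoalg.isDonkinQH_iff S hA).2 ((QHCoalg.isDlabRingelQH_iff S hA).1 h)
  · have hA := QHCoalg.costandardAbsorbs_of_isDonkinQH S h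
    exact ⟨QHCoalg.nablaD_eq_nablaDR S hA l, QHCoalg.kerDeltaD_eq_kerDeltaDR S hA l⟩
  · have hA := QHCoalg.costandardAbsorbs_of_isDonkinQH S h
    exact ⟨(QHCoalg.isDonkinQH_iff S hA).1 h,
      (QHCoalg.extOrdered_iff S).1 (S.extOrdered_of_costandardAbsorbs hA)⟩
  · have hA := S.costandardAbsorbs_of_extOrdered ((QHCoalg.extOrdered_iff S).2 h2)
    exact (QHCoalg.isDonkinQH_iff S hA).2 h1
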